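/- Consider one bosonic mode, i.e. a complex Hilbert space with an orthonormal Fock basis $|0\rangle,|1\rangle,|2\rangle,\dots$ and the operators $a|n\rangle=\sqrt n\,|n-1\rangle$, $a^\dagger|n\rangle=\sqrt{n+1}\,|n+1\rangle$. A state is a positive operator $\rho$ of trace one; $S(\rho)=-\operatorname{Tr}(\rho\ln\rho)\in[0,\infty]$ is its von Neumann entropy. For $\bar n\ge 0$ let $\rho^{\rm th}_{\bar n}=\sum_{n\ge 0}\frac{\bar n^n}{(1+\bar n)^{n+1}}|n\rangle\langle n|$ be the thermal state of mean photon number $\bar n$; its entropy is $g(\bar n)=(\bar n+1)\ln(\bar n+1)-\bar n\ln\bar n$, and $g:[0,\infty)\to[0,\infty)$ is a bijection. For $\gamma_+,\gamma_-\ge 0$ let $\Phi_t=e^{t\mathcal L}$, $t\ge 0$, be the single-mode gauge-covariant semigroup generated by $\mathcal L=\gamma_+\mathcal L_++\gamma_-\mathcal L_-$, where $$\mathcal L_+(\rho)=a^\dagger\rho a-\tfrac12 aa^\dagger\rho-\tfrac12\rho aa^\dagger,\qquad \mathcal L_-(\rho)=a\rho a^\dagger-\tfrac12 a^\dagger a\rho-\tfrac12\rho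 a^\dagger a .$$ That is, for a state $\rho$, $t\mapsto\Phi_t(\rho)$ is the state-valued solution of $\frac{d}{dt}\rho(t)=\mathcal L(\rho(t))$, $\rho(0)=\rho$, the equation being understood for all matrix elements in the Fock basis. Fix $\gamma_+,\gamma_-\ge 0$. **Infinitesimal statement.** For every real $S_0>0$ and every state $\rho$ with $S(\rho)=S_0$, $$\frac{d}{dt}S(\Phi_t(\rho))\Big|_{t=0}\ \ge\ \frac{d}{dt}S\big(\Phi_t(\rho^{\rm th}_{g^{-1}(S_0)})\big)\Big|_{t=0},$$ where the derivatives are derivatives from the right with values in $[-\infty,\infty]$, and the inequality is required whenever they exist. **Finite-time statement.** For every real $S_0\ge 0$, every state $\rho$ with $S(\rho)=S_0$ and every $t\ge 0$, $$S(\Phi_t(\rho))\ \ge\ S\big(\Phi_t(\rho^{\rm th}_{g^{-1}(S_0)})\big).$$ **Lemma.** If the infinitesimal statement holds for the semigroup with rates $\gamma_+,\gamma_-$, then the finite-time statement holds for the same semigroup. -/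

import Mathlib

open Filter Topology
open scoped ENNReal InnerProductSpace

noncomputable section

section Mode

variable {H : Type*} [NormedAddCommGroup H] [InnerProductSpace ℂ H] [CompleteSpace H]

/-! A single bosonic mode is a complex Hilbert space `H` together with its Fock basis
`|0⟩, |1⟩, |2⟩, …`, a Hilbert basis `fock : HilbertBasis ℕ ℂ H`. -/

/-- A density operator: positive (hence self-adjoint) with unit trace. -/
def IsDensity (fock : HilbertBasis ℕ ℂ H) (ρ : H →L[ℂ] H) : Prop :=
  ρ.IsPositive ∧ HasSum (fun n : ℕ => ⟪fock n, ρ (fock n)⟫_ℂ) 1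

/-- The von Neumann entropy `S(ρ) = -Tr(ρ ln ρ) ∈ [0, ∞]`: the trace, taken in the Fock basis, of
the operator obtained from `ρ` by the continuous functional calculus of `x ↦ -x ln x`. For a density
operator this operator is positive, so every summand is a non-negative real number. -/
def vnEntropy (fock : HilbertBasis ℕ ℂ H) (ρ : H →L[ℂ] H) : ℝ≥0∞ :=
  ∑' n : ℕ, ENNReal.ofReal (⟪fock n, (cfc Real.negMulLog ρ) (fock n)⟫_ℂ).re

/-- `g(n̄) = (n̄ + 1) ln (n̄ + 1) - n̄ ln n̄`, the entropy of the thermal state of mean photon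
number `n̄ ≥ 0` (with `0 ln 0 = 0`). -/
def thermalEntropy (nbar : ℝ) : ℝ :=
  (nbar + 1) * Real.log (nbar + 1) - nbar * Real.log nbar

/-- The thermal state `∑ₙ n̄ⁿ / (1 + n̄)ⁿ⁺¹ |n⟩⟨n|` of mean photon number `n̄ ≥ 0` (the series
converges in operator norm). -/
def thermal (fock : HilbertBasis ℕ ℂ H) (nbar : ℝ) : H →L[ℂ] H :=
  ∑' n : ℕ, ((nbar ^ n / (1 + nbar) ^ (n + 1) : ℝ) : ℂ) •
    InnerProductSpace.rankOne ℂ (fock n) (fock n)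

/-- The annihilation operator on finite-photon vectors, written in Fock coordinates:
`a|n⟩ = √n |n-1⟩` (in particular `a|0⟩ = 0`). -/
def annihilate : (ℕ →₀ ℂ) →ₗ[ℂ] (ℕ →₀ ℂ) :=
  Finsupp.linearCombination ℂ fun n : ℕ => Finsupp.single (n - 1) ((Real.sqrt n : ℝ) : ℂ)

/-- The creation operator on finite-photon vectors: `a†|n⟩ = √(n+1) |n+1⟩`. -/
def create : (ℕ →₀ ℂ) →ₗ[ℂ] (ℕ →₀ ℂ) :=
  Finsupp.linearCombination ℂ fun n : ℕ => Finsupp.single (n + 1) ((Real.sqrt (n + 1) : ℝ) : ℂ)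

/-- `⟨u|ρ|v⟩` for vectors `u`, `v` with finitely many Fock coordinates. -/
def matrixElement (fock : HilbertBasis ℕ ℂ H) (ρ : H →L[ℂ] H) (u v : ℕ →₀ ℂ) : ℂ :=
  ⟪Finsupp.linearCombination ℂ fock u, ρ (Finsupp.linearCombination ℂ fock v)⟫_ℂ

/-- `⟨u|L₊(ρ)|v⟩` with `L₊(ρ) = a†ρa - ½ aa†ρ - ½ ρaa†`, the factors to the left of `ρ` being moved
to `u` as adjoints. -/
def lindbladPlus (fock : HilbertBasis ℕ ℂ H) (ρ : H →L[ℂ] H) (u v : ℕ →₀ ℂ) : ℂ :=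
  matrixElement fock ρ (annihilate u) (annihilate v)
    - (1 / 2) * matrixElement fock ρ (annihilate (create u)) v
    - (1 / 2) * matrixElement fock ρ u (annihilate (create v))

/-- `⟨u|L₋(ρ)|v⟩` with `L₋(ρ) = aρa† - ½ a†aρ - ½ ρa†a`. -/
def lindbladMinus (fock : HilbertBasis ℕ ℂ H) (ρ : H →L[ℂ] H) (u v : ℕ →₀ ℂ) : ℂ :=
  matrixElement fock ρ (create u) (create v)
    - (1 / 2) * matrixElement fock ρ (create (annihilate u)) v
    - (1 / 2) * matrixElement fock ρ u (create (annihilate v))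

/-- `⟨u|L(ρ)|v⟩` with `L = γ₊ L₊ + γ₋ L₋`. -/
def lindblad (fock : HilbertBasis ℕ ℂ H) (γp γm : ℝ) (ρ : H →L[ℂ] H) (u v : ℕ →₀ ℂ) : ℂ :=
  (γp : ℂ) * lindbladPlus fock ρ u v + (γm : ℂ) * lindbladMinus fock ρ u v

/-- `r` is an orbit `t ↦ Φ_t(ρ) = e^{tL}(ρ)`, `t ≥ 0`, of the single-mode gauge-covariant semigroup
with rates `γ₊, γ₋`: it takes its values in the density operators and solves the master equation
`dr/dt = L(r)` tested against the Fock basis. Only the values `r t` with `t ≥ 0` matter. There is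
exactly one such orbit (on `t ≥ 0`) for each initial density operator. -/
def IsOrbit (fock : HilbertBasis ℕ ℂ H) (γp γm : ℝ) (r : ℝ → (H →L[ℂ] H)) : Prop :=
  (∀ t : ℝ, 0 ≤ t → IsDensity fock (r t)) ∧
  ∀ m n : ℕ, ∀ t : ℝ, 0 ≤ t →
    HasDerivWithinAt
      (fun s : ℝ => matrixElement fock (r s) (Finsupp.single m 1) (Finsupp.single n 1))
      (lindblad fock γp γm (r t) (Finsupp.single m 1) (Finsupp.single n 1)) (Set.Ici 0) t

/-- The derivative of `t ↦ S(r t)` at `t = 0` (from the right) exists in `[-∞, ∞]` and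
equals `d`. -/
def HasEntropyRate (fock : HilbertBasis ℕ ℂ H) (r : ℝ → (H →L[ℂ] H)) (d : EReal) : Prop :=
  Tendsto
    (fun t : ℝ => ((vnEntropy fock (r t) : EReal) - (vnEntropy fock (r 0) : EReal)) / (t : EReal))
    (𝓝[>] 0) (𝓝 d)

/-- The infinitesimal minimum output entropy conjecture for the semigroup with rates `γ₊, γ₋`:
for every input state `r 0` of entropy `S₀ > 0`, the derivative at `t = 0` of the output entropy,
whenever it exists in `[-∞, ∞]`, is at least the one for the thermal input state of
entropy `S₀`. -/
def InfinitesimalMinOutputEntropy (fock : HilbertBasis ℕ ℂ H) (γp γm : ℝ) : Prop :=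
  ∀ S₀ : ℝ, 0 < S₀ → ∀ nbar : ℝ, 0 ≤ nbar → thermalEntropy nbar = S₀ →
    ∀ r rth : ℝ → (H →L[ℂ] H),
      IsOrbit fock γp γm r → vnEntropy fock (r 0) = ENNReal.ofReal S₀ →
      IsOrbit fock γp γm rth → rth 0 = thermal fock nbar →
      ∀ d dth : EReal, HasEntropyRate fock r d → HasEntropyRate fock rth dth → dth ≤ d

/-- The minimum output entropy conjecture for the semigroup with rates `γ₊, γ₋`: for every input
state `r 0` of entropy `S₀ ≥ 0` and every `t ≥ 0`, the output entropy at time `t` is at least the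
one for the thermal input state of entropy `S₀`. -/
def MinOutputEntropy (fock : HilbertBasis ℕ ℂ H) (γp γm : ℝ) : Prop :=
  ∀ S₀ : ℝ, 0 ≤ S₀ → ∀ nbar : ℝ, 0 ≤ nbar → thermalEntropy nbar = S₀ →
    ∀ r rth : ℝ → (H →L[ℂ] H),
      IsOrbit fock γp γm r → vnEntropy fock (r 0) = ENNReal.ofReal S₀ →
      IsOrbit fock γp γm rth → rth 0 = thermal fock nbar →
      ∀ t : ℝ, 0 ≤ t → vnEntropy fock (rth t) ≤ vnEntropy fock (r t)

end Mode

end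

set_option linter.unusedSectionVars false

/-! ### Spectral theory of density operators and the entropy in an eigenbasis. -/

section Spectral

universe u

variable {H : Type u} [NormedAddCommGroup H] [InnerProductSpace ℂ H] [CompleteSpace H]

/-! Write `S(r t) = g(N t)`, so that `N t` is the photon number of the thermal state with the
entropy of `r t`. A thermal state stays thermal, and its photon number `m` solves `m' = γ₊(m + 1) -
γ₋ m`. Restarting the orbit at time `t` and comparing with the thermal orbit from `N t`, the
infinitesimal statement gives `N' ≥ γ₊(N + 1) - γ₋ N` wherever `N` is differentiable and positive,
since the factor `g'(N) > 0` cancels. It remains to conclude `N ≥ m` from `N 0 = m 0`.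

The obstacle is regularity: nothing says that the entropy along an orbit is differentiable, or even
continuous. What is available is the one-sided bound `S(r s) ≤ S(r t) + |γ₋ - γ₊|(t - s)` for `s ≤
t` (`IsOrbit.vnEntropy_le`). It also shows that the entropy is finite before any time at which it is
finite. Hence `f = e^{(γ₋ - γ₊)t}(N - m)` becomes monotone after adding a multiple of `t`. A
monotone function is differentiable almost everywhere and increases by at least the integral of its
derivative; as `f' ≥ 0` wherever it exists, `f T ≥ f 0 = 0` (`le_of_monotoneOn_add_mul`).

The entropy bound comes from `L(1) = (γ₋ - γ₊) 1` and trace preservation. The numbers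
`⟨e_i|Φ_t(|f_j⟩⟨f_j|)|e_i⟩` between eigenbases of `r t` and `r 0` have row sums at most `e^{(γ₋ -
γ₊)t}` and column sums at least one, and concavity of `-x ln x` does the rest. Only orbits are
given, not the map `Φ_t`, so it is replaced by partial sums of the Dyson series. These are positive,
and every orbit dominates them. They lose no trace in the limit because the underlying birth and
death process does not explode; this also yields uniqueness of orbits.

Zero entropy is outside the infinitesimal statement. At an interior time with `N t = 0`, `N` has a
minimum, so its derivative, if any, is zero. This suffices for `γ₊ = 0`, whereas for `γ₊ > 0` no
state is pure at positive time (`IsOrbit.vnEntropy_ne_zero`). -/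

theorem isCompactOperator_rankOne (x y : H) :
    IsCompactOperator (InnerProductSpace.rankOne ℂ x y : H →L[ℂ] H) := by
  rw [InnerProductSpace.rankOne_def']
  exact ((isCompactOperator_id (E := ℂ)).comp_clm (innerSL ℂ y)).clm_comp
    (ContinuousLinearMap.toSpanSingleton ℂ x)

theorem HilbertBasis.hasSum_norm_inner_sq {ι : Type*} (b : HilbertBasis ι ℂ H) (x : H) :
    HasSum (fun i => ‖⟪b i, x⟫_ℂ‖ ^ 2) (‖x‖ ^ 2) := by
  have h := Complex.hasSum_re (b.hasSum_inner_mul_inner x x)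
  convert h using 1
  · ext i
    rw [← inner_conj_symm x (b i), ← Complex.normSq_eq_conj_mul_self, Complex.ofReal_re,
      Complex.normSq_eq_norm_sq]
  · exact (inner_self_eq_norm_sq (𝕜 := ℂ) x).symm

/-- A Hilbert–Schmidt operator is a norm limit of finite-rank ones: the error of the truncation `F
N` is controlled by the tail of the summable series. -/
theorem HilbertBasis.isCompactOperator_of_summable (b : HilbertBasis ℕ ℂ H) {A : H →L[ℂ] H}
    (hA : IsSelfAdjoint A) (hs : Summable fun n => ‖A (b n)‖ ^ 2) : IsCompactOperator A := by
  have hsym : ∀ x y, ⟪A x, y⟫_ℂ = ⟪x, A y⟫_ℂ := fun x y => hA.isSymmetric x y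
  set F : ℕ → H →L[ℂ] H := fun N =>
    ∑ n ∈ Finset.range N, InnerProductSpace.rankOne ℂ (b n) (A (b n)) with hF
  have key : ∀ N, ‖A - F N‖ ≤ Real.sqrt (∑' n, ‖A (b (n + N))‖ ^ 2) := by
    intro N
    refine ContinuousLinearMap.opNorm_le_bound _ (Real.sqrt_nonneg _) fun x => ?_
    have hin : ∀ m, ⟪b m, (A - F N) x⟫_ℂ = if m < N then 0 else ⟪A (b m), x⟫_ℂ := by
      intro m
      have h1 : (A - F N) x = A x - ∑ n ∈ Finset.range N, ⟪A (b n), x⟫_ℂ • b n := by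
        simp [hF]
      rw [h1, inner_sub_right, inner_sum, hsym]
      simp only [inner_smul_right, orthonormal_iff_ite.mp b.orthonormal, mul_ite, mul_one, mul_zero,
        Finset.sum_ite_eq, Finset.mem_range, hsym]
      split_ifs <;> simp
    have hsum := b.hasSum_norm_inner_sq ((A - F N) x)
    simp only [hin] at hsum
    rw [← hasSum_nat_add_iff' N] at hsum
    rw [Finset.sum_eq_zero (fun i hi => by simp [Finset.mem_range.mp hi]), sub_zero] at hsum
    have hle : ‖(A - F N) x‖ ^ 2 ≤ (∑' n, ‖A (b (n + N))‖ ^ 2) * ‖x‖ ^ 2 := by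
      rw [← hsum.tsum_eq, ← tsum_mul_right]
      refine hsum.summable.tsum_le_tsum (fun n => ?_)
        (((summable_nat_add_iff N).mpr hs).mul_right _)
      rw [if_neg (by omega), ← mul_pow]
      gcongr
      exact norm_inner_le_norm _ _
    rw [← Real.sqrt_sq (norm_nonneg x), ← Real.sqrt_mul (tsum_nonneg fun _ => by positivity)]
    exact Real.le_sqrt_of_sq_le hle
  have hlim : Tendsto F atTop (𝓝 A) := by
    rw [tendsto_iff_norm_sub_tendsto_zero]
    have h0 : Tendsto (fun N => Real.sqrt (∑' n, ‖A (b (n + N))‖ ^ 2)) atTop (𝓝 0) := by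
      have := (tendsto_sum_nat_add fun n => ‖A (b n)‖ ^ 2)
      have h := (Real.continuous_sqrt.tendsto 0).comp this
      rwa [Real.sqrt_zero] at h
    refine squeeze_zero (fun _ => norm_nonneg _) (fun N => ?_) h0
    rw [norm_sub_rev]; exact key N
  refine isCompactOperator_of_tendsto hlim (Eventually.of_forall fun N => ?_)
  have : F N ∈ compactOperator (RingHom.id ℂ) H H :=
    Submodule.sum_mem _ fun n _ => isCompactOperator_rankOne _ _
  exact this

/-- The trace of `ρ` is the squared Hilbert–Schmidt norm of `√ρ`, so `√ρ` is compact, and with it `ρ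
= √ρ √ρ`. -/
theorem IsDensity.isCompactOperator {fock : HilbertBasis ℕ ℂ H} {ρ : H →L[ℂ] H}
    (h : IsDensity fock ρ) : IsCompactOperator ρ := by
  have hpos : 0 ≤ ρ := (ContinuousLinearMap.nonneg_iff_isPositive ρ).mpr h.1
  set A := CFC.sqrt ρ with hAdef
  have hA : IsSelfAdjoint A := (CFC.sqrt_nonneg ρ).isSelfAdjoint
  have hAA : A * A = ρ := CFC.sqrt_mul_sqrt_self ρ
  have hsq : ∀ n, ‖A (fock n)‖ ^ 2 = (⟪fock n, ρ (fock n)⟫_ℂ).re := by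
    intro n
    have h1 : ⟪A (fock n), A (fock n)⟫_ℂ = ⟪fock n, A (A (fock n))⟫_ℂ := hA.isSymmetric _ _
    rw [← hAA, mul_apply_eq_comp, ← h1]
    exact (inner_self_eq_norm_sq (𝕜 := ℂ) _).symm
  have hc : IsCompactOperator A := fock.isCompactOperator_of_summable hA (by
    simp only [hsq]; exact (Complex.hasSum_re h.2).summable)
  rw [← hAA]
  exact hc.clm_comp A

/-- Hilbert bases of all eigenspaces, the kernel included, are glued together; the spectral theorem
for compact operators leaves nothing orthogonal to their union. -/
theorem exists_hilbertBasis_eigenvectors {T : H →L[ℂ] H} (hc : IsCompactOperator T)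
    (hs : T.IsSymmetric) :
    ∃ (ι : Type u) (e : HilbertBasis ι ℂ H) (p : ι → ℂ), ∀ i, T (e i) = p i • e i := by
  have hc' : ∀ μ, CompleteSpace (Module.End.eigenspace (T : Module.End ℂ H) μ) := fun μ => by
    have : IsClosed ((Module.End.eigenspace (T : Module.End ℂ H) μ : Submodule ℂ H) : Set H) := by
      have : ((Module.End.eigenspace (T : Module.End ℂ H) μ : Submodule ℂ H) : Set H)
          = {x | T x = μ • x} := by
        ext x; exact Module.End.mem_eigenspace_iff
      rw [this]
      exact isClosed_eq T.continuous (continuous_const_smul μ)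
    exact this.completeSpace_coe
  choose w b hb using fun μ : ℂ =>
    exists_hilbertBasis ℂ (Module.End.eigenspace (T : Module.End ℂ H) μ)
  have hv := (LinearMap.IsSymmetric.orthogonalFamily_eigenspaces hs).orthonormal_sigma_orthonormal
    (v_family := fun μ => b μ) (fun μ => (b μ).orthonormal)
  set v : (Σ μ, w μ) → H := fun a =>
    ((b a.1 a.2 : Module.End.eigenspace (T : Module.End ℂ H) a.1) : H) with hvdef
  replace hv : Orthonormal ℂ v := hv
  have hbot : (Submodule.span ℂ (Set.range v))ᗮ = ⊥ := by
    rw [eq_bot_iff, ← ContinuousLinearMap.orthogonalComplement_iSup_eigenspaces_eq_bot hc hs]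
    intro x hx
    rw [Submodule.mem_orthogonal'] at hx
    rw [← Submodule.iInf_orthogonal, Submodule.mem_iInf]
    intro μ
    rw [Submodule.mem_orthogonal]
    intro y hy
    have h0 := (b μ).hasSum_repr ⟨y, hy⟩
    have h1 := h0.mapL ((Module.End.eigenspace (T : Module.End ℂ H) μ).subtypeL)
    have h2 := h1.mapL (innerSL ℂ x)
    have h3 : ⟪x, y⟫_ℂ = 0 := by
      refine h2.unique ?_
      convert hasSum_zero with i
      simp only [map_smul, Submodule.subtypeL_apply, innerSL_apply_apply]
      rw [hx _ (Submodule.subset_span ⟨⟨μ, i⟩, rfl⟩), smul_zero]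
    rw [← inner_conj_symm, h3, map_zero]
  refine ⟨Σ μ, w μ, HilbertBasis.mkOfOrthogonalEqBot hv hbot, fun a => a.1, fun a => ?_⟩
  rw [HilbertBasis.coe_mkOfOrthogonalEqBot]
  exact Module.End.mem_eigenspace_iff.mp (b a.1 a.2).2

/-- Clear for constants and the identity, stable under sums, products and limits, hence true for
every continuous function by Stone–Weierstrass. -/
theorem cfc_apply_eigenvector {T : H →L[ℂ] H} (hT : IsSelfAdjoint T) {f : ℝ → ℝ}
    (hf : Continuous f) {x : H} {p : ℝ} (hx : T x = (p : ℂ) • x) :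
    cfc f T x = (f p : ℂ) • x := by
  rcases eq_or_ne x 0 with rfl | hx0
  · simp
  have hp : p ∈ spectrum ℝ T := by
    rw [spectrum.mem_iff, Algebra.algebraMap_eq_smul_one]
    intro hu
    have hz : ((p • 1 - T : H →L[ℂ] H)) x = 0 := by
      simp [hx]
    obtain ⟨u, hu⟩ := hu
    have := congrArg (fun S : H →L[ℂ] H => S x) u.inv_mul
    simp only [mul_apply_eq_comp, hu, hz, map_zero, one_apply_eq_self] at this
    exact hx0 this.symm
  have hcomp : CompactSpace (spectrum ℝ T) := isCompact_iff_compactSpace.mp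
    (spectrum.isCompact T)
  have key : ∀ g : C(spectrum ℝ T, ℝ), cfcHom (show IsSelfAdjoint T from hT) g x
      = (g ⟨p, hp⟩ : ℂ) • x := by
    intro g
    induction g using ContinuousMap.induction_on_of_compact with
    | const r =>
      have : ContinuousMap.const (spectrum ℝ T) r = algebraMap ℝ C(spectrum ℝ T, ℝ) r := rfl
      rw [this, AlgHomClass.commutes]
      rw [Algebra.algebraMap_eq_smul_one]
      rfl
    | id => rw [cfcHom_id]; simpa using hx
    | star_id => rw [star_trivial, cfcHom_id]; simpa using hx
    | add f g hf hg =>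
      rw [map_add, add_apply, hf, hg, ContinuousMap.add_apply, Complex.ofReal_add, add_smul]
    | mul f g hf hg =>
      rw [map_mul, mul_apply_eq_comp, hg, map_smul, hf, ContinuousMap.mul_apply,
        Complex.ofReal_mul, smul_smul, mul_comm]
    | frequently f h =>
      have hcl : IsClosed {g : C(spectrum ℝ T, ℝ) |
          cfcHom (show IsSelfAdjoint T from hT) g x = (g ⟨p, hp⟩ : ℂ) • x} := by
        refine isClosed_eq ?_ ?_
        · have h1 : Continuous (cfcHom (show IsSelfAdjoint T from hT) :
              C(spectrum ℝ T, ℝ) → (H →L[ℂ] H)) := cfcHom_continuous hT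
          exact h1.clm_apply continuous_const
        · have : Continuous fun g : C(spectrum ℝ T, ℝ) => g ⟨p, hp⟩ :=
            continuous_eval_const _
          fun_prop
      exact hcl.mem_of_frequently_of_tendsto h tendsto_id
  rw [cfc_apply f T hT hf.continuousOn, key]
  rfl

theorem hasSum_eigenvalue_mul_norm_sq {A : H →L[ℂ] H} (hA : IsSelfAdjoint A) {ι : Type*}
    (e : HilbertBasis ι ℂ H) {p : ι → ℝ} (he : ∀ i, A (e i) = (p i : ℂ) • e i) (x : H) :
    HasSum (fun i => p i * ‖⟪e i, x⟫_ℂ‖ ^ 2) (⟪x, A x⟫_ℂ).re := by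
  have h := Complex.hasSum_re (e.hasSum_inner_mul_inner x (A x))
  have h2 : ∀ i, (⟪x, e i⟫_ℂ * ⟪e i, A x⟫_ℂ).re = p i * ‖⟪e i, x⟫_ℂ‖ ^ 2 := by
    intro i
    have h3 : ⟪A (e i), x⟫_ℂ = ⟪e i, A x⟫_ℂ := hA.isSymmetric _ _
    rw [← h3, he, inner_smul_left, Complex.conj_ofReal, mul_left_comm, ← inner_conj_symm x (e i),
      ← Complex.normSq_eq_conj_mul_self, ← Complex.ofReal_mul, Complex.ofReal_re,
      Complex.normSq_eq_norm_sq]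
  simpa only [h2] using h

/-- Basis independence of the trace by Tonelli. Working in `[0, ∞]` avoids any trace-class
assumption. -/
theorem tsum_ofReal_inner_eq (fock : HilbertBasis ℕ ℂ H) {A : H →L[ℂ] H} (hA : IsSelfAdjoint A)
    {ι : Type*} (e : HilbertBasis ι ℂ H) {p : ι → ℝ} (he : ∀ i, A (e i) = (p i : ℂ) • e i)
    (hp : ∀ i, 0 ≤ p i) :
    ∑' n, ENNReal.ofReal (⟪fock n, A (fock n)⟫_ℂ).re = ∑' i, ENNReal.ofReal (p i) := by
  have hx : ∀ x : H, ENNReal.ofReal (⟪x, A x⟫_ℂ).re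
      = ∑' i, ENNReal.ofReal (p i) * ENNReal.ofReal (‖⟪e i, x⟫_ℂ‖ ^ 2) := by
    intro x
    have h := hasSum_eigenvalue_mul_norm_sq hA e he x
    rw [← h.tsum_eq, ENNReal.ofReal_tsum_of_nonneg (fun i => mul_nonneg (hp i) (by positivity))
      h.summable]
    exact tsum_congr fun i => ENNReal.ofReal_mul (hp i)
  simp only [hx]
  rw [ENNReal.tsum_comm]
  refine tsum_congr fun i => ?_
  rw [ENNReal.tsum_mul_left]
  have h := fock.hasSum_norm_inner_sq (e i)
  rw [e.orthonormal.1 i] at h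
  simp only [norm_inner_symm (fock _)] at h
  rw [← ENNReal.ofReal_tsum_of_nonneg (fun _ => by positivity) h.summable, h.tsum_eq]
  simp

theorem vnEntropy_eq_tsum (fock : HilbertBasis ℕ ℂ H) {ρ : H →L[ℂ] H} (hρ : IsSelfAdjoint ρ)
    {ι : Type*} (e : HilbertBasis ι ℂ H) {p : ι → ℝ} (he : ∀ i, ρ (e i) = (p i : ℂ) • e i)
    (hp : ∀ i, 0 ≤ Real.negMulLog (p i)) :
    vnEntropy fock ρ = ∑' i, ENNReal.ofReal (Real.negMulLog (p i)) :=
  tsum_ofReal_inner_eq fock (cfc_predicate _ _) e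
    (fun i => cfc_apply_eigenvector hρ Real.continuous_negMulLog (he i)) hp

theorem hasSum_eigenvalues {ρ : H →L[ℂ] H} {fock : HilbertBasis ℕ ℂ H} (h : IsDensity fock ρ)
    {ι : Type*} (e : HilbertBasis ι ℂ H) {p : ι → ℝ} (he : ∀ i, ρ (e i) = (p i : ℂ) • e i) :
    (∀ i, 0 ≤ p i) ∧ HasSum p 1 := by
  have hp : ∀ i, 0 ≤ p i := by
    intro i
    have := h.1.inner_nonneg_right (e i)
    rw [he, inner_smul_right, inner_self_eq_norm_sq_to_K, e.orthonormal.1 i] at this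
    simpa using this
  refine ⟨hp, ?_⟩
  have hre := Complex.hasSum_re h.2
  have h1 : ∑' i, ENNReal.ofReal (p i) = 1 := by
    rw [← tsum_ofReal_inner_eq fock h.1.isSelfAdjoint e he hp,
      ← ENNReal.ofReal_tsum_of_nonneg _ hre.summable, hre.tsum_eq]
    · simp
    · intro n
      exact (Complex.nonneg_iff.mp (h.1.inner_nonneg_right (fock n))).1
  have hsum : Summable p := by
    have := ENNReal.summable_toReal (f := fun i => ENNReal.ofReal (p i)) (by rw [h1]; simp)
    simpa [ENNReal.toReal_ofReal (hp _)] using this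
  rw [← ENNReal.ofReal_tsum_of_nonneg hp hsum] at h1
  have : ∑' i, p i = 1 := by simpa using h1
  exact this ▸ hsum.hasSum

theorem IsDensity.exists_spectral {fock : HilbertBasis ℕ ℂ H} {ρ : H →L[ℂ] H}
    (h : IsDensity fock ρ) :
    ∃ (ι : Type u) (e : HilbertBasis ι ℂ H) (p : ι → ℝ), (∀ i, ρ (e i) = (p i : ℂ) • e i) ∧
      (∀ i, 0 ≤ p i) ∧ (∀ i, 0 ≤ Real.negMulLog (p i)) ∧ HasSum p 1 ∧
      vnEntropy fock ρ = ∑' i, ENNReal.ofReal (Real.negMulLog (p i)) := by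
  obtain ⟨ι, e, z, hz⟩ := exists_hilbertBasis_eigenvectors h.isCompactOperator
    h.1.isSymmetric
  have hreal : ∀ i, ((z i).re : ℂ) = z i := by
    intro i
    have := h.1.inner_nonneg_right (e i)
    rw [hz, inner_smul_right, inner_self_eq_norm_sq_to_K, e.orthonormal.1 i] at this
    have := (Complex.nonneg_iff.mp this).2
    apply Complex.ext <;> simp at this ⊢
    exact this
  have he : ∀ i, ρ (e i) = (((z i).re : ℝ) : ℂ) • e i := fun i => by rw [hreal, hz]
  obtain ⟨hp, hs⟩ := hasSum_eigenvalues h e he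
  have hn : ∀ i, 0 ≤ Real.negMulLog (z i).re := fun i =>
    Real.negMulLog_nonneg (hp i) (le_hasSum hs i fun j _ => hp j)
  exact ⟨ι, e, fun i => (z i).re, he, hp, hn, hs,
    vnEntropy_eq_tsum fock h.1.isSelfAdjoint e he hn⟩

end Spectral

/-! ### Infinite matrices, positivity and the Dyson series. -/

noncomputable section

section Kernel

open ComplexConjugate

/-- The real part of the quadratic form of an infinite matrix on the first `N` coordinates. -/
def qform (X : ℕ → ℕ → ℂ) (N : ℕ) (u : ℕ → ℂ) : ℝ :=
  (∑ j ∈ Finset.range N, ∑ k ∈ Finset.range N, conj (u j) * X j k * u k).re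

/-- Positivity of an infinite matrix, tested on finitely supported vectors. -/
def PosKernel (X : ℕ → ℕ → ℂ) : Prop := ∀ N u, 0 ≤ qform X N u

/-- The total rate at which the Fock level `l` is left. -/
def lossRate (γp γm : ℝ) (l : ℕ) : ℝ := γp * (l + 1) + γm * l

/-- The decay rate of the matrix element `(j, k)`. -/
def decayRate (γp γm : ℝ) (j k : ℕ) : ℝ := (lossRate γp γm j + lossRate γp γm k) / 2

/-- The jump part `γ₊ a†Xa + γ₋ aXa†` of the generator, on matrices. -/
def gain (γp γm : ℝ) (X : ℕ → ℕ → ℂ) (j k : ℕ) : ℂ :=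
  ((γp * (Real.sqrt j * Real.sqrt k) : ℝ) : ℂ) * X (j - 1) (k - 1)
    + ((γm * (Real.sqrt (j + 1) * Real.sqrt (k + 1)) : ℝ) : ℂ) * X (j + 1) (k + 1)

/-- The right-hand side of the integrated master equation. -/
def duhamel (γp γm : ℝ) (X : ℕ → ℕ → ℂ) (Y : ℝ → ℕ → ℕ → ℂ) (t : ℝ) (j k : ℕ) : ℂ :=
  (Real.exp (-(decayRate γp γm j k * t)) : ℂ) * (X j k + ∫ s in (0 : ℝ)..t,
    (Real.exp (decayRate γp γm j k * s) : ℂ) * gain γp γm (Y s) j k)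

/-- The partial sums of the Dyson series: at most `n - 1` jumps. -/
def dyson (γp γm : ℝ) (X : ℕ → ℕ → ℂ) : ℕ → ℝ → ℕ → ℕ → ℂ
  | 0 => fun _ _ _ => 0
  | n + 1 => duhamel γp γm X (dyson γp γm X n)

variable {γp γm : ℝ}

theorem qform_add (X Y : ℕ → ℕ → ℂ) (N : ℕ) (u : ℕ → ℂ) :
    qform (fun j k => X j k + Y j k) N u = qform X N u + qform Y N u := by
  simp only [qform, mul_add, add_mul, Finset.sum_add_distrib, Complex.add_re]

theorem qform_sub (X Y : ℕ → ℕ → ℂ) (N : ℕ) (u : ℕ → ℂ) :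
    qform (fun j k => X j k - Y j k) N u = qform X N u - qform Y N u := by
  simp only [qform, mul_sub, sub_mul, Finset.sum_sub_distrib, Complex.sub_re]

theorem qform_sum {ι : Type*} (F : Finset ι) (X : ι → ℕ → ℕ → ℂ) (N : ℕ) (u : ℕ → ℂ) :
    qform (fun j k => ∑ i ∈ F, X i j k) N u = ∑ i ∈ F, qform (X i) N u := by
  simp only [qform, Finset.mul_sum, Finset.sum_mul, ← Complex.re_sum]
  congr 1
  rw [Finset.sum_comm (s := F)]
  refine Finset.sum_congr rfl fun j _ => ?_
  rw [Finset.sum_comm]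

theorem qform_smul (a : ℝ) (X : ℕ → ℕ → ℂ) (N : ℕ) (u : ℕ → ℂ) :
    qform (fun j k => (a : ℂ) * X j k) N u = a * qform X N u := by
  rw [qform, qform, ← Complex.re_ofReal_mul, Finset.mul_sum]
  congr 1
  refine Finset.sum_congr rfl fun j _ => ?_
  rw [Finset.mul_sum]
  refine Finset.sum_congr rfl fun k _ => ?_
  ring

theorem qform_rankOne (a : ℕ → ℂ) (N : ℕ) (u : ℕ → ℂ) :
    qform (fun j k => a j * conj (a k)) N u
      = ‖∑ k ∈ Finset.range N, conj (a k) * u k‖ ^ 2 := by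
  rw [← Complex.normSq_eq_norm_sq, qform, ← Complex.ofReal_re (Complex.normSq _),
    Complex.normSq_eq_conj_mul_self, map_sum, Finset.sum_mul_sum]
  congr 1
  refine Finset.sum_congr rfl fun j _ => Finset.sum_congr rfl fun k _ => ?_
  simp only [map_mul, Complex.conj_conj]
  ring

/-- Each jump term is a congruence, so its quadratic form is that of `X` at a shifted and weighted
vector. The truncated `j - 1` at `j = 0` is harmless because its weight is `√0`. -/
theorem PosKernel.gain {X : ℕ → ℕ → ℂ} (hX : PosKernel X) (hγp : 0 ≤ γp) (hγm : 0 ≤ γm) :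
    PosKernel (gain γp γm X) := by
  intro N u
  have h1 : qform (fun j k => ((Real.sqrt j * Real.sqrt k : ℝ) : ℂ) * X (j - 1) (k - 1)) N u
      = qform X (N - 1) (fun j => (Real.sqrt (j + 1) : ℂ) * u (j + 1)) := by
    rcases N with _ | N
    · simp [qform]
    · simp only [qform, Finset.sum_range_succ', Nat.add_sub_cancel]
      simp only [Nat.cast_zero, Real.sqrt_zero, zero_mul, mul_zero, Complex.ofReal_zero,
        Finset.sum_const_zero, add_zero, map_mul, Complex.conj_ofReal, Complex.ofReal_mul,
        Nat.cast_add, Nat.cast_one]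
      congr 1
      refine Finset.sum_congr rfl fun j _ => Finset.sum_congr rfl fun k _ => ?_
      ring
  have h2 : qform (fun j k => ((Real.sqrt (j + 1) * Real.sqrt (k + 1) : ℝ) : ℂ)
        * X (j + 1) (k + 1)) N u
      = qform X (N + 1) (fun j => (Real.sqrt j : ℂ) * u (j - 1)) := by
    simp only [qform, Finset.sum_range_succ', Nat.add_sub_cancel]
    simp only [Nat.cast_zero, Real.sqrt_zero, zero_mul, mul_zero, Complex.ofReal_zero, map_zero,
      Finset.sum_const_zero, add_zero, map_mul, Complex.conj_ofReal, Complex.ofReal_mul,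
      Nat.cast_add, Nat.cast_one]
    congr 1
    refine Finset.sum_congr rfl fun j _ => Finset.sum_congr rfl fun k _ => ?_
    ring
  have h3 : qform (_root_.gain γp γm X) N u
      = γp * qform X (N - 1) (fun j => (Real.sqrt (j + 1) : ℂ) * u (j + 1))
        + γm * qform X (N + 1) (fun j => (Real.sqrt j : ℂ) * u (j - 1)) := by
    rw [← h1, ← h2, ← qform_smul, ← qform_smul, ← qform_add]
    congr 1
    ext j k
    simp only [_root_.gain, Complex.ofReal_mul]
    ring
  rw [h3]
  exact add_nonneg (mul_nonneg hγp (hX _ _)) (mul_nonneg hγm (hX _ _))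

theorem continuousOn_gain {Y : ℝ → ℕ → ℕ → ℂ} {s : Set ℝ}
    (hY : ∀ j k, ContinuousOn (fun t => Y t j k) s) (j k : ℕ) :
    ContinuousOn (fun t => gain γp γm (Y t) j k) s :=
  (continuousOn_const.mul (hY _ _)).add (continuousOn_const.mul (hY _ _))

theorem continuousOn_duhamel_integrand {Y : ℝ → ℕ → ℕ → ℂ} {s : Set ℝ}
    (hY : ∀ j k, ContinuousOn (fun t => Y t j k) s) (j k : ℕ) :
    ContinuousOn (fun t => (Real.exp (decayRate γp γm j k * t) : ℂ) * gain γp γm (Y t) j k) s :=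
  ContinuousOn.mul (by fun_prop) (continuousOn_gain hY j k)

theorem intervalIntegrable_duhamel {Y : ℝ → ℕ → ℕ → ℂ}
    (hY : ∀ j k, ContinuousOn (fun t => Y t j k) (Set.Ici 0)) {t : ℝ} (ht : 0 ≤ t) (j k : ℕ) :
    IntervalIntegrable (fun t => (Real.exp (decayRate γp γm j k * t) : ℂ) * gain γp γm (Y t) j k)
      MeasureTheory.volume 0 t := by
  refine ContinuousOn.intervalIntegrable ((continuousOn_duhamel_integrand hY j k).mono ?_)
  rw [Set.uIcc_of_le ht]
  exact Set.Icc_subset_Ici_self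

theorem continuous_dyson (X : ℕ → ℕ → ℂ) (n : ℕ) (j k : ℕ) :
    Continuous fun t => dyson γp γm X n t j k := by
  induction n generalizing j k with
  | zero => exact continuous_const
  | succ n ih =>
    have h : Continuous fun t => (Real.exp (decayRate γp γm j k * t) : ℂ)
        * gain γp γm (dyson γp γm X n t) j k := by
      rw [← continuousOn_univ]
      exact continuousOn_duhamel_integrand (fun j k => (ih j k).continuousOn) j k
    have h2 : Continuous fun t : ℝ => ∫ s in (0 : ℝ)..t,
        (Real.exp (decayRate γp γm j k * s) : ℂ) * gain γp γm (dyson γp γm X n s) j k :=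
      intervalIntegral.continuous_primitive (fun a b => h.intervalIntegrable a b) 0
    change Continuous fun t => (Real.exp (-(decayRate γp γm j k * t)) : ℂ) * (X j k + _)
    fun_prop

/-- The decay rate at `(j, k)` is the half-sum of a rate in `j` and one in `k`, so the exponential
factor is a congruence by a diagonal matrix. Both the initial term and the integrand are therefore
positive. -/
theorem PosKernel.duhamel {X : ℕ → ℕ → ℂ} {Y : ℝ → ℕ → ℕ → ℂ} (hX : PosKernel X)
    (hγp : 0 ≤ γp) (hγm : 0 ≤ γm)
    (hY : ∀ j k, ContinuousOn (fun t => Y t j k) (Set.Ici 0))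
    (hpos : ∀ t, 0 ≤ t → PosKernel (Y t)) {t : ℝ} (ht : 0 ≤ t) :
    PosKernel (duhamel γp γm X Y t) := by
  intro N u
  set v : ℝ → ℕ → ℂ := fun s j => (Real.exp (-(lossRate γp γm j * (t - s) / 2)) : ℂ) * u j with hv
  have hexp : ∀ s j k, (Real.exp (-(decayRate γp γm j k * t)) : ℂ)
        * (Real.exp (decayRate γp γm j k * s) : ℂ)
      = (Real.exp (-(lossRate γp γm j * (t - s) / 2)) : ℂ)
        * (Real.exp (-(lossRate γp γm k * (t - s) / 2)) : ℂ) := by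
    intro s j k
    rw [← Complex.ofReal_mul, ← Complex.ofReal_mul, ← Real.exp_add, ← Real.exp_add]
    congr 2
    simp only [decayRate]
    ring
  have hint : ∀ j k, IntervalIntegrable (fun s => conj (v s j) * _root_.gain γp γm (Y s) j k * v s k)
      MeasureTheory.volume 0 t := by
    intro j k
    refine ContinuousOn.intervalIntegrable ?_
    rw [Set.uIcc_of_le ht]
    refine ContinuousOn.mul (ContinuousOn.mul ?_
      ((continuousOn_gain hY j k).mono Set.Icc_subset_Ici_self)) ?_
    · refine Continuous.continuousOn (Complex.continuous_conj.comp ?_)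
      simp only [hv]; fun_prop
    · refine Continuous.continuousOn ?_
      simp only [hv]; fun_prop
  have hterm : ∀ j k, conj (u j) * _root_.duhamel γp γm X Y t j k * u k
      = conj (v 0 j) * X j k * v 0 k
        + ∫ s in (0 : ℝ)..t, conj (v s j) * _root_.gain γp γm (Y s) j k * v s k := by
    intro j k
    have h1 : ∀ s, conj (v s j) * _root_.gain γp γm (Y s) j k * v s k
        = (conj (u j) * u k * (Real.exp (-(decayRate γp γm j k * t)) : ℂ))
          * ((Real.exp (decayRate γp γm j k * s) : ℂ) * _root_.gain γp γm (Y s) j k) := by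
      intro s
      have := hexp s j k
      simp only [hv, map_mul, Complex.conj_ofReal]
      linear_combination (-(conj (u j) * u k * _root_.gain γp γm (Y s) j k)) * this
    have h0 : conj (v 0 j) * X j k * v 0 k
        = conj (u j) * u k * (Real.exp (-(decayRate γp γm j k * t)) : ℂ) * X j k := by
      have := hexp 0 j k
      simp only [mul_zero, Real.exp_zero, Complex.ofReal_one, mul_one] at this
      simp only [hv, map_mul, Complex.conj_ofReal]
      linear_combination (-(conj (u j) * u k * X j k)) * this
    simp only [h1, h0, intervalIntegral.integral_const_mul, _root_.duhamel]
    ring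
  have hq : qform (_root_.duhamel γp γm X Y t) N u
      = qform X N (v 0) + ∫ s in (0 : ℝ)..t, qform (_root_.gain γp γm (Y s)) N (v s) := by
    simp only [qform, hterm, Finset.sum_add_distrib, Complex.add_re]
    congr 1
    have h1 : ∀ j ∈ Finset.range N, IntervalIntegrable
        (fun s => ∑ k ∈ Finset.range N, conj (v s j) * _root_.gain γp γm (Y s) j k * v s k)
        MeasureTheory.volume 0 t := fun j _ => by
      simpa only [Finset.sum_fn] using IntervalIntegrable.sum (Finset.range N) fun k _ => hint j k
    have h2 : IntervalIntegrable (fun s => ∑ j ∈ Finset.range N,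
        ∑ k ∈ Finset.range N, conj (v s j) * _root_.gain γp γm (Y s) j k * v s k)
        MeasureTheory.volume 0 t := by
      simpa only [Finset.sum_fn] using IntervalIntegrable.sum (Finset.range N) h1
    have h3 := Complex.reCLM.intervalIntegral_comp_comm h2
    simp only [Complex.reCLM_apply] at h3
    rw [h3, intervalIntegral.integral_finsetSum h1]
    congr 1
    refine Finset.sum_congr rfl fun j _ => ?_
    rw [intervalIntegral.integral_finsetSum fun k _ => hint j k]
  rw [hq]
  exact add_nonneg (hX _ _) (intervalIntegral.integral_nonneg ht fun s hs =>
    (hpos s hs.1).gain hγp hγm _ _)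

theorem duhamel_sub (X X' : ℕ → ℕ → ℂ) {Y Y' : ℝ → ℕ → ℕ → ℂ}
    (hY : ∀ j k, ContinuousOn (fun t => Y t j k) (Set.Ici 0))
    (hY' : ∀ j k, ContinuousOn (fun t => Y' t j k) (Set.Ici 0)) {t : ℝ} (ht : 0 ≤ t) :
    duhamel γp γm (fun j k => X j k - X' j k) (fun t j k => Y t j k - Y' t j k) t
      = fun j k => duhamel γp γm X Y t j k - duhamel γp γm X' Y' t j k := by
  ext j k
  have h : ∀ s, (Real.exp (decayRate γp γm j k * s) : ℂ)
        * gain γp γm (fun j k => Y s j k - Y' s j k) j k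
      = (Real.exp (decayRate γp γm j k * s) : ℂ) * gain γp γm (Y s) j k
        - (Real.exp (decayRate γp γm j k * s) : ℂ) * gain γp γm (Y' s) j k := by
    intro s; simp only [gain]; ring
  simp only [duhamel, h]
  rw [intervalIntegral.integral_sub (intervalIntegrable_duhamel hY ht j k)
    (intervalIntegrable_duhamel hY' ht j k)]
  ring

theorem dyson_sum {ι : Type*} (F : Finset ι) (X : ι → ℕ → ℕ → ℂ) (n : ℕ) (t : ℝ) :
    dyson γp γm (fun j k => ∑ i ∈ F, X i j k) n t
      = fun j k => ∑ i ∈ F, dyson γp γm (X i) n t j k := by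
  induction n generalizing t with
  | zero => ext j k; simp [dyson]
  | succ n ih =>
    ext j k
    have h : ∀ s, (Real.exp (decayRate γp γm j k * s) : ℂ)
          * gain γp γm (fun j k => ∑ i ∈ F, dyson γp γm (X i) n s j k) j k
        = ∑ i ∈ F, (Real.exp (decayRate γp γm j k * s) : ℂ)
          * gain γp γm (dyson γp γm (X i) n s) j k := by
      intro s
      simp only [gain, Finset.mul_sum, ← Finset.sum_add_distrib]
    change duhamel γp γm _ (dyson γp γm _ n) t j k
      = ∑ i ∈ F, duhamel γp γm (X i) (dyson γp γm (X i) n) t j k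
    simp only [duhamel, ih, h]
    rw [intervalIntegral.integral_finsetSum, ← Finset.sum_add_distrib, Finset.mul_sum]
    intro i _
    refine Continuous.intervalIntegrable ?_ _ _
    rw [← continuousOn_univ]
    exact continuousOn_duhamel_integrand (fun j k => (continuous_dyson _ _ j k).continuousOn) j k

theorem dyson_smul (a : ℝ) (X : ℕ → ℕ → ℂ) (n : ℕ) (t : ℝ) :
    dyson γp γm (fun j k => (a : ℂ) * X j k) n t = fun j k => (a : ℂ) * dyson γp γm X n t j k := by
  induction n generalizing t with
  | zero => ext j k; simp [dyson]
  | succ n ih =>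
    ext j k
    have h : ∀ s, (Real.exp (decayRate γp γm j k * s) : ℂ)
          * gain γp γm (fun j k => (a : ℂ) * dyson γp γm X n s j k) j k
        = (a : ℂ) * ((Real.exp (decayRate γp γm j k * s) : ℂ)
          * gain γp γm (dyson γp γm X n s) j k) := by
      intro s
      simp only [gain]
      ring
    change duhamel γp γm _ (dyson γp γm _ n) t j k
      = (a : ℂ) * duhamel γp γm X (dyson γp γm X n) t j k
    simp only [duhamel, ih, h, intervalIntegral.integral_const_mul]
    ring

theorem PosKernel.dyson {X : ℕ → ℕ → ℂ} (hX : PosKernel X) (hγp : 0 ≤ γp) (hγm : 0 ≤ γm)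
    (n : ℕ) {t : ℝ} (ht : 0 ≤ t) : PosKernel (dyson γp γm X n t) := by
  induction n generalizing t with
  | zero => intro N u; simp [_root_.dyson, qform]
  | succ n ih =>
    exact hX.duhamel hγp hγm (fun j k => (continuous_dyson _ _ j k).continuousOn)
      (fun s hs => ih hs) ht

/-- The Duhamel map is linear and positive. Hence a positive fixed point starting above `X` stays
above each Picard iterate that starts from zero with initial matrix `X`. -/
theorem posKernel_sub_dyson (hγp : 0 ≤ γp) (hγm : 0 ≤ γm) {X₀ X : ℕ → ℕ → ℂ}
    {Y : ℝ → ℕ → ℕ → ℂ} (hY : ∀ j k, ContinuousOn (fun t => Y t j k) (Set.Ici 0))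
    (hfix : ∀ t, 0 ≤ t → Y t = duhamel γp γm X₀ Y t) (hpos : ∀ t, 0 ≤ t → PosKernel (Y t))
    (hX : PosKernel fun j k => X₀ j k - X j k) (n : ℕ) {t : ℝ} (ht : 0 ≤ t) :
    PosKernel fun j k => Y t j k - dyson γp γm X n t j k := by
  induction n generalizing t with
  | zero => simpa [dyson] using hpos t ht
  | succ n ih =>
    have hc : ∀ j k, ContinuousOn (fun t => dyson γp γm X n t j k) (Set.Ici 0) :=
      fun j k => (continuous_dyson _ _ j k).continuousOn
    have h := duhamel_sub (γp := γp) (γm := γm) X₀ X hY hc ht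
    have h2 : (fun j k => Y t j k - dyson γp γm X (n + 1) t j k)
        = duhamel γp γm (fun j k => X₀ j k - X j k)
          (fun t j k => Y t j k - dyson γp γm X n t j k) t := by
      rw [h]
      ext j k
      rw [← hfix t ht]
      rfl
    rw [h2]
    exact hX.duhamel hγp hγm (fun j k => (hY j k).sub (hc j k)) (fun s hs => ih hs) ht

/-- The multiple `e^{(γ₋ - γ₊) t}` of the identity solves the integrated master equation. -/
def expIdentity (γp γm : ℝ) (t : ℝ) (j k : ℕ) : ℂ :=
  if j = k then (Real.exp ((γm - γp) * t) : ℂ) else 0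

/-- This is `L(1) = (γ₋ - γ₊) 1`: on the diagonal the gain exceeds the loss by exactly `γ₋ - γ₊`. -/
theorem expIdentity_eq_duhamel (t : ℝ) :
    expIdentity γp γm t = duhamel γp γm (expIdentity γp γm 0) (expIdentity γp γm) t := by
  ext j k
  by_cases hjk : j = k
  · subst hjk
    have hg : ∀ s, (Real.exp (decayRate γp γm j j * s) : ℂ)
          * gain γp γm (expIdentity γp γm s) j j
        = (((decayRate γp γm j j + (γm - γp)) *
            Real.exp ((decayRate γp γm j j + (γm - γp)) * s) : ℝ) : ℂ) := by
      intro s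
      have h1 : Real.sqrt j * Real.sqrt j = j := Real.mul_self_sqrt (by positivity)
      have h2 : Real.sqrt (j + 1) * Real.sqrt (j + 1) = (j : ℝ) + 1 :=
        Real.mul_self_sqrt (by positivity)
      simp only [gain, expIdentity, if_true, h1, h2]
      rw [add_mul (decayRate γp γm j j) (γm - γp) s, Real.exp_add]
      simp only [decayRate, lossRate]
      push_cast
      ring
    have hI : ∫ s in (0 : ℝ)..t, ((decayRate γp γm j j + (γm - γp)) *
        Real.exp ((decayRate γp γm j j + (γm - γp)) * s))
        = Real.exp ((decayRate γp γm j j + (γm - γp)) * t) - 1 := by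
      have hd : ∀ s ∈ Set.uIcc 0 t, HasDerivAt
          (fun s => Real.exp ((decayRate γp γm j j + (γm - γp)) * s))
          ((decayRate γp γm j j + (γm - γp)) *
            Real.exp ((decayRate γp γm j j + (γm - γp)) * s)) s := by
        intro s _
        have := ((hasDerivAt_id s).const_mul (decayRate γp γm j j + (γm - γp))).exp
        simpa [mul_comm] using this
      rw [intervalIntegral.integral_eq_sub_of_hasDerivAt hd
        (Continuous.intervalIntegrable (by fun_prop) _ _)]
      simp
    simp only [duhamel, hg]
    rw [intervalIntegral.integral_ofReal, hI]
    simp only [expIdentity, if_true, mul_zero, Real.exp_zero]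
    rw [← Complex.ofReal_add, ← Complex.ofReal_mul]
    congr 1
    rw [add_sub_cancel, ← Real.exp_add]
    congr 1
    ring
  · have hg : ∀ s, gain γp γm (expIdentity γp γm s) j k = 0 := by
      intro s
      have h2 : ¬ (j + 1 = k + 1) := by omega
      simp only [gain, expIdentity, h2, if_false, mul_zero, add_zero]
      split_ifs with h
      · have : j = 0 ∨ k = 0 := by omega
        rcases this with rfl | rfl <;> simp
      · simp
    simp [duhamel, hg, expIdentity, hjk]

theorem qform_expIdentity (t : ℝ) (N : ℕ) (u : ℕ → ℂ) :
    qform (expIdentity γp γm t) N u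
      = Real.exp ((γm - γp) * t) * ∑ j ∈ Finset.range N, ‖u j‖ ^ 2 := by
  have h : ∀ j ∈ Finset.range N, ∑ k ∈ Finset.range N, conj (u j) * expIdentity γp γm t j k * u k
      = ((Real.exp ((γm - γp) * t) * ‖u j‖ ^ 2 : ℝ) : ℂ) := by
    intro j hj
    simp only [expIdentity, mul_ite, ite_mul, mul_zero, zero_mul, Finset.sum_ite_eq, hj, if_true]
    rw [Complex.ofReal_mul, ← Complex.normSq_eq_norm_sq, Complex.normSq_eq_conj_mul_self]
    ring
  rw [qform, Finset.sum_congr rfl h, ← Complex.ofReal_sum, Complex.ofReal_re, Finset.mul_sum]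

/-- Domination by the exact solution started at the identity; this is the source of the row-sum
bound for the transition matrix. -/
theorem qform_dyson_le (hγp : 0 ≤ γp) (hγm : 0 ≤ γm) {X : ℕ → ℕ → ℂ}
    (hX : PosKernel fun j k => (if j = k then 1 else 0) - X j k) (n N : ℕ) {t : ℝ} (ht : 0 ≤ t)
    (u : ℕ → ℂ) :
    qform (dyson γp γm X n t) N u
      ≤ Real.exp ((γm - γp) * t) * ∑ j ∈ Finset.range N, ‖u j‖ ^ 2 := by
  have h := posKernel_sub_dyson (γp := γp) (γm := γm) hγp hγm (X₀ := expIdentity γp γm 0) (X := X)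
    (Y := expIdentity γp γm) (fun j k => by unfold expIdentity; split_ifs <;> fun_prop)
    (fun t _ => expIdentity_eq_duhamel t)
    (fun t _ N u => by rw [qform_expIdentity]; positivity)
    (by simpa [expIdentity] using hX) n ht N u
  rw [qform_sub, qform_expIdentity] at h
  linarith

end Kernel
end

/-! ### The birth and death process of the Fock populations, and its non-explosion. -/

noncomputable section

section Occupation

variable {γp γm : ℝ}

/-- The gain part of the rate equation for the Fock populations. -/
def populationGain (γp γm : ℝ) (y : ℕ → ℝ) (l : ℕ) : ℝ :=
  γp * l * y (l - 1) + γm * (l + 1) * y (l + 1)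

/-- The Fock populations of the partial sums of the Dyson series. -/
def population (γp γm : ℝ) (x : ℕ → ℝ) : ℕ → ℝ → ℕ → ℝ
  | 0 => fun _ _ => 0
  | n + 1 => fun t l => Real.exp (-(lossRate γp γm l * t)) * (x l + ∫ s in (0 : ℝ)..t,
      Real.exp (lossRate γp γm l * s) * populationGain γp γm (population γp γm x n s) l)

theorem continuous_populationGain {y : ℝ → ℕ → ℝ} (hy : ∀ l, Continuous fun t => y t l) (l : ℕ) :
    Continuous fun t => populationGain γp γm (y t) l :=
  (continuous_const.mul (hy _)).add (continuous_const.mul (hy _))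

theorem hasDerivAt_population_succ_of_continuous (x : ℕ → ℝ) (n : ℕ)
    (h : ∀ l, Continuous fun t => population γp γm x n t l) (t : ℝ) (l : ℕ) :
    HasDerivAt (fun t => population γp γm x (n + 1) t l)
      (-(lossRate γp γm l) * population γp γm x (n + 1) t l
        + populationGain γp γm (population γp γm x n t) l) t := by
  have hc : Continuous fun s => Real.exp (lossRate γp γm l * s)
      * populationGain γp γm (population γp γm x n s) l :=
    (by fun_prop : Continuous fun s => Real.exp (lossRate γp γm l * s)).mul
      (continuous_populationGain h l)
  have h1 := intervalIntegral.integral_hasDerivAt_right (hc.intervalIntegrable 0 t)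
    (hc.stronglyMeasurableAtFilter _ _) hc.continuousAt
  have h2 : HasDerivAt (fun t => Real.exp (-(lossRate γp γm l * t)))
      (-(lossRate γp γm l) * Real.exp (-(lossRate γp γm l * t))) t := by
    have := ((hasDerivAt_id t).const_mul (lossRate γp γm l)).neg.exp
    simpa [mul_comm] using this
  refine (h2.mul (h1.const_add (x l))).congr_deriv ?_
  have h3 : Real.exp (-(lossRate γp γm l * t)) * Real.exp (lossRate γp γm l * t) = 1 := by
    rw [← Real.exp_add]; simp
  change _ = -(lossRate γp γm l) * (Real.exp (-(lossRate γp γm l * t)) * (x l + _)) + _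
  linear_combination (populationGain γp γm (population γp γm x n t) l) * h3

theorem continuous_population (x : ℕ → ℝ) (n l : ℕ) :
    Continuous fun t => population γp γm x n t l := by
  induction n generalizing l with
  | zero => exact continuous_const
  | succ n ih =>
    exact continuous_iff_continuousAt.mpr fun t =>
      (hasDerivAt_population_succ_of_continuous x n ih t l).continuousAt

theorem hasDerivAt_population_succ (x : ℕ → ℝ) (n : ℕ) (t : ℝ) (l : ℕ) :
    HasDerivAt (fun t => population γp γm x (n + 1) t l)
      (-(lossRate γp γm l) * population γp γm x (n + 1) t l
        + populationGain γp γm (population γp γm x n t) l) t :=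
  hasDerivAt_population_succ_of_continuous x n (continuous_population x n) t l

theorem population_succ_zero (x : ℕ → ℝ) (n l : ℕ) : population γp γm x (n + 1) 0 l = x l := by
  simp [population]

theorem intervalIntegrable_population (x : ℕ → ℝ) (n l : ℕ) (a b : ℝ) :
    IntervalIntegrable (fun s => Real.exp (lossRate γp γm l * s)
      * populationGain γp γm (population γp γm x n s) l) MeasureTheory.volume a b :=
  ((by fun_prop : Continuous fun s => Real.exp (lossRate γp γm l * s)).mul
    (continuous_populationGain (continuous_population x n) l)).intervalIntegrable _ _

theorem populationGain_mono (hγp : 0 ≤ γp) (hγm : 0 ≤ γm) {y z : ℕ → ℝ} (h : ∀ l, y l ≤ z l)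
    (l : ℕ) : populationGain γp γm y l ≤ populationGain γp γm z l := by
  unfold populationGain
  have h1 := h (l - 1)
  have h2 := h (l + 1)
  gcongr

theorem population_mono_init (hγp : 0 ≤ γp) (hγm : 0 ≤ γm) {x y : ℕ → ℝ} (h : ∀ l, x l ≤ y l)
    (n : ℕ) {t : ℝ} (ht : 0 ≤ t) (l : ℕ) :
    population γp γm x n t l ≤ population γp γm y n t l := by
  induction n generalizing t l with
  | zero => exact le_rfl
  | succ n ih =>
    have h1 := h l
    have h2 := intervalIntegral.integral_mono_on ht (intervalIntegrable_population x n l 0 t)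
      (intervalIntegrable_population (γp := γp) (γm := γm) y n l 0 t) fun s hs =>
        mul_le_mul_of_nonneg_left (populationGain_mono hγp hγm (ih hs.1) l) (Real.exp_nonneg _)
    simp only [population]
    gcongr

theorem population_nonneg (hγp : 0 ≤ γp) (hγm : 0 ≤ γm) {x : ℕ → ℝ} (hx : ∀ l, 0 ≤ x l)
    (n : ℕ) {t : ℝ} (ht : 0 ≤ t) (l : ℕ) : 0 ≤ population γp γm x n t l := by
  induction n generalizing t l with
  | zero => exact le_rfl
  | succ n ih =>
    refine mul_nonneg (Real.exp_nonneg _) (add_nonneg (hx l)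
      (intervalIntegral.integral_nonneg ht fun s hs => mul_nonneg (Real.exp_nonneg _) ?_))
    have h1 := ih hs.1 (l - 1)
    have h2 := ih hs.1 (l + 1)
    unfold populationGain
    positivity

theorem population_le_succ (hγp : 0 ≤ γp) (hγm : 0 ≤ γm) {x : ℕ → ℝ} (hx : ∀ l, 0 ≤ x l)
    (n : ℕ) {t : ℝ} (ht : 0 ≤ t) (l : ℕ) :
    population γp γm x n t l ≤ population γp γm x (n + 1) t l := by
  induction n generalizing t l with
  | zero => exact population_nonneg hγp hγm hx 1 ht l
  | succ n ih =>
    have h2 := intervalIntegral.integral_mono_on ht (intervalIntegrable_population x n l 0 t)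
      (intervalIntegrable_population (γp := γp) (γm := γm) x (n + 1) l 0 t) fun s hs =>
        mul_le_mul_of_nonneg_left (populationGain_mono hγp hγm (ih hs.1) l) (Real.exp_nonneg _)
    exact mul_le_mul_of_nonneg_left (add_le_add le_rfl h2) (Real.exp_nonneg _)

theorem population_mono (hγp : 0 ≤ γp) (hγm : 0 ≤ γm) {x : ℕ → ℝ} (hx : ∀ l, 0 ≤ x l)
    {n m : ℕ} (hnm : n ≤ m) {t : ℝ} (ht : 0 ≤ t) (l : ℕ) :
    population γp γm x n t l ≤ population γp γm x m t l :=
  monotone_nat_of_le_succ (f := fun n => population γp γm x n t l)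
    (fun n => population_le_succ hγp hγm hx n ht l) hnm

theorem population_eq_zero {x : ℕ → ℝ} {M : ℕ} (hx : ∀ l, M ≤ l → x l = 0) (n : ℕ) (t : ℝ)
    {l : ℕ} (hl : M + n ≤ l) : population γp γm x n t l = 0 := by
  induction n generalizing t l with
  | zero => rfl
  | succ n ih =>
    have h : ∀ s, populationGain γp γm (population γp γm x n s) l = 0 := fun s => by
      rw [populationGain, ih s (by omega), ih s (by omega)]; ring
    simp [population, hx l (by omega), h]

/-- Summation by parts. Already `c (L - 1) = 0` is needed, since the upward jump from level `L - 1`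
would leave the range of summation. -/
theorem sum_mul_populationGain {c : ℕ → ℝ} {L : ℕ} (hc : ∀ l, L ≤ l + 1 → c l = 0) (w : ℕ → ℝ) :
    ∑ l ∈ Finset.range L, w l * populationGain γp γm c l
      = ∑ l ∈ Finset.range L, (γp * (l + 1) * w (l + 1) + γm * l * w (l - 1)) * c l := by
  rcases L with _ | L
  · simp
  have h1 : ∑ l ∈ Finset.range (L + 1), w l * (γp * l * c (l - 1))
      = ∑ l ∈ Finset.range (L + 1), γp * (l + 1) * w (l + 1) * c l := by
    rw [Finset.sum_range_succ', Finset.sum_range_succ (fun l : ℕ => γp * (l + 1) * w (l + 1) * c l),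
      hc L le_rfl]
    simp only [Nat.cast_zero, mul_zero, zero_mul, add_zero]
    refine Finset.sum_congr rfl fun l _ => ?_
    push_cast
    ring
  have h2 : ∑ l ∈ Finset.range (L + 1), w l * (γm * (l + 1) * c (l + 1))
      = ∑ l ∈ Finset.range (L + 1), γm * l * w (l - 1) * c l := by
    rw [Finset.sum_range_succ, Finset.sum_range_succ' (fun l : ℕ => γm * l * w (l - 1) * c l),
      hc (L + 1) (by omega)]
    simp only [Nat.cast_zero, mul_zero, zero_mul, add_zero]
    refine Finset.sum_congr rfl fun l _ => ?_
    push_cast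
    ring
  simp only [populationGain, mul_add (w _), add_mul _ _ (c _), Finset.sum_add_distrib, h1, h2]

theorem le_of_hasDerivAt_nonpos {f f' : ℝ → ℝ} (hf : ∀ s, HasDerivAt f (f' s) s) {t : ℝ}
    (ht : 0 ≤ t) (h : ∀ s, 0 ≤ s → s ≤ t → f' s ≤ 0) : f t ≤ f 0 := by
  have : AntitoneOn f (Set.Icc 0 t) := antitoneOn_of_deriv_nonpos (convex_Icc 0 t)
    (fun s _ => (hf s).continuousAt.continuousWithinAt)
    (fun s _ => (hf s).differentiableAt.differentiableWithinAt) fun s hs => by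
      rw [interior_Icc] at hs
      rw [(hf s).deriv]
      exact h s hs.1.le hs.2.le
  exact this (Set.left_mem_Icc.mpr ht) (Set.right_mem_Icc.mpr ht) ht

/-- A Grönwall estimate. The adjoint generator sends the weight `l + 1` to `γ₊(l + 1) - γ₋ l ≤ γ₊(l
+ 1)`; the gain, which involves the previous partial sum, is first enlarged by monotonicity in `n`.
-/
theorem population_energy_le (hγp : 0 ≤ γp) (hγm : 0 ≤ γm) {x : ℕ → ℝ} (hx : ∀ l, 0 ≤ x l)
    {M : ℕ} (hM : ∀ l, M ≤ l → x l = 0) (n : ℕ) {L : ℕ} (hL : M + n + 1 ≤ L) {t : ℝ}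
    (ht : 0 ≤ t) :
    ∑ l ∈ Finset.range L, ((l : ℝ) + 1) * population γp γm x n t l
      ≤ Real.exp (γp * t) * ∑ l ∈ Finset.range L, ((l : ℝ) + 1) * x l := by
  rcases n with _ | n
  · simp only [population, mul_zero, Finset.sum_const_zero]
    exact mul_nonneg (Real.exp_nonneg _) (Finset.sum_nonneg fun l _ =>
      mul_nonneg (by positivity) (hx l))
  set E : ℝ → ℝ := fun t => ∑ l ∈ Finset.range L, ((l : ℝ) + 1) * population γp γm x (n + 1) t l
    with hE
  have hd : ∀ s, HasDerivAt (fun s => Real.exp (-(γp * s)) * E s)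
      ((-γp * Real.exp (-(γp * s))) * E s + Real.exp (-(γp * s)) *
        ∑ l ∈ Finset.range L, ((l : ℝ) + 1) * (-(lossRate γp γm l) * population γp γm x (n + 1) s l
        + populationGain γp γm (population γp γm x n s) l)) s := by
    intro s
    have h2 : HasDerivAt (fun t => Real.exp (-(γp * t))) (-γp * Real.exp (-(γp * s))) s := by
      have := ((hasDerivAt_id s).const_mul γp).neg.exp
      simpa [mul_comm] using this
    refine h2.mul ?_
    exact HasDerivAt.fun_sum fun l _ => (hasDerivAt_population_succ x n s l).const_mul _
  have hle := le_of_hasDerivAt_nonpos hd ht fun s hs _ => by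
    have h1 : ∑ l ∈ Finset.range L, ((l : ℝ) + 1) * (-(lossRate γp γm l)
          * population γp γm x (n + 1) s l + populationGain γp γm (population γp γm x n s) l)
        ≤ γp * E s := by
      simp only [mul_add, Finset.sum_add_distrib]
      rw [sum_mul_populationGain (fun l hl => population_eq_zero hM n s (by omega)),
        ← Finset.sum_add_distrib, hE, Finset.mul_sum]
      refine Finset.sum_le_sum fun l _ => ?_
      have h3 := population_le_succ hγp hγm hx n hs l
      have h4 := population_nonneg hγp hγm hx (n + 1) hs l
      have h5 : (l : ℝ) * (((l - 1 : ℕ) : ℝ) + 1) = l * l := by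
        rcases l with _ | l
        · simp
        · push_cast [Nat.add_sub_cancel]; ring
      have h6 : γp * (l + 1) * (((l + 1 : ℕ) : ℝ) + 1) + γm * l * (((l - 1 : ℕ) : ℝ) + 1)
          = γp * (l + 1) * (l + 2) + γm * (l * l) := by
        push_cast
        linear_combination γm * h5
      rw [h6]
      have h7 : (γp * (l + 1) * (l + 2) + γm * (l * l)) * population γp γm x n s l
          ≤ (γp * (l + 1) * (l + 2) + γm * (l * l)) * population γp γm x (n + 1) s l := by
        gcongr
      have h8 : 0 ≤ γm * l * population γp γm x (n + 1) s l := by positivity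
      simp only [lossRate]
      nlinarith
    have h2 : 0 < Real.exp (-(γp * s)) := Real.exp_pos _
    nlinarith
  simp only [mul_zero, neg_zero, Real.exp_zero, one_mul] at hle
  have h0 : E 0 = ∑ l ∈ Finset.range L, ((l : ℝ) + 1) * x l := by
    simp only [hE, population_succ_zero]
  rw [h0] at hle
  calc E t = Real.exp (γp * t) * (Real.exp (-(γp * t)) * E t) := by
        rw [← mul_assoc, ← Real.exp_add]; simp
    _ ≤ _ := mul_le_mul_of_nonneg_left hle (Real.exp_nonneg _)

/-- Markov's inequality for the number of jumps: the mass missing from the `N`-th sum sits on paths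
with at least `N` jumps, and the expected number of jumps is bounded through the energy.
Analytically, the masses of the first `N` sums are added up, so that their derivatives telescope to
one total loss rate. -/
theorem population_mass_deficit (hγp : 0 ≤ γp) (hγm : 0 ≤ γm) {x : ℕ → ℝ} (hx : ∀ l, 0 ≤ x l)
    {M : ℕ} (hM : ∀ l, M ≤ l → x l = 0) (N : ℕ) {L : ℕ} (hL : M + N + 1 ≤ L) {t : ℝ}
    (ht : 0 ≤ t) :
    N * (∑ l ∈ Finset.range L, x l - ∑ l ∈ Finset.range L, population γp γm x N t l)
      ≤ (γp + γm) * (Real.exp (γp * t) * ∑ l ∈ Finset.range L, ((l : ℝ) + 1) * x l) * t := by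
  set B := (γp + γm) * (Real.exp (γp * t) * ∑ l ∈ Finset.range L, ((l : ℝ) + 1) * x l) with hB
  have hd : ∀ s, HasDerivAt (fun s => -(∑ n ∈ Finset.range N, ∑ l ∈ Finset.range L,
        population γp γm x (n + 1) s l) - B * s)
      (-(∑ n ∈ Finset.range N, ∑ l ∈ Finset.range L, (-(lossRate γp γm l)
        * population γp γm x (n + 1) s l
        + populationGain γp γm (population γp γm x n s) l)) - B) s := by
    intro s
    refine HasDerivAt.sub (HasDerivAt.neg (HasDerivAt.fun_sum fun n _ => HasDerivAt.fun_sum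
      fun l _ => hasDerivAt_population_succ x n s l)) ?_
    simpa using (hasDerivAt_id s).const_mul B
  have hle := le_of_hasDerivAt_nonpos hd ht fun s hs hst => by
    have h1 : ∀ n ∈ Finset.range N, ∑ l ∈ Finset.range L, (-(lossRate γp γm l)
          * population γp γm x (n + 1) s l
          + populationGain γp γm (population γp γm x n s) l)
        = ∑ l ∈ Finset.range L, lossRate γp γm l * population γp γm x n s l
          - ∑ l ∈ Finset.range L, lossRate γp γm l * population γp γm x (n + 1) s l := by
      intro n hn
      have hn := Finset.mem_range.mp hn
      have := sum_mul_populationGain (γp := γp) (γm := γm) (c := population γp γm x n s) (L := L)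
        (fun l hl => population_eq_zero hM n s (by omega)) (fun _ => 1)
      simp only [one_mul, mul_one] at this
      rw [Finset.sum_add_distrib, this]
      simp only [lossRate, neg_mul, Finset.sum_neg_distrib]
      ring
    rw [Finset.sum_congr rfl h1, Finset.sum_range_sub' (fun n => ∑ l ∈ Finset.range L,
      lossRate γp γm l * population γp γm x n s l) N]
    have h2 : ∑ l ∈ Finset.range L, lossRate γp γm l * population γp γm x N s l
        ≤ (γp + γm) * ∑ l ∈ Finset.range L, ((l : ℝ) + 1) * population γp γm x N s l := by
      rw [Finset.mul_sum]
      refine Finset.sum_le_sum fun l _ => ?_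
      rw [← mul_assoc]
      refine mul_le_mul_of_nonneg_right ?_ (population_nonneg hγp hγm hx N hs l)
      simp only [lossRate]
      nlinarith
    have h3 := population_energy_le hγp hγm hx hM N hL hs
    have h4 : Real.exp (γp * s) * ∑ l ∈ Finset.range L, ((l : ℝ) + 1) * x l
        ≤ Real.exp (γp * t) * ∑ l ∈ Finset.range L, ((l : ℝ) + 1) * x l := by
      have : 0 ≤ ∑ l ∈ Finset.range L, ((l : ℝ) + 1) * x l :=
        Finset.sum_nonneg fun l _ => mul_nonneg (by positivity) (hx l)
      gcongr
    have h5 : (γp + γm) * ∑ l ∈ Finset.range L, ((l : ℝ) + 1) * population γp γm x N s l ≤ B :=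
      mul_le_mul_of_nonneg_left (h3.trans h4) (by positivity)
    simp only [population, mul_zero, Finset.sum_const_zero]
    linarith
  simp only [population_succ_zero, Finset.sum_const, Finset.card_range, nsmul_eq_mul,
    mul_zero, sub_zero] at hle
  have h6 : ∑ n ∈ Finset.range N, ∑ l ∈ Finset.range L, population γp γm x (n + 1) t l
      ≤ N * ∑ l ∈ Finset.range L, population γp γm x N t l := by
    have := Finset.sum_le_card_nsmul (Finset.range N)
      (fun n => ∑ l ∈ Finset.range L, population γp γm x (n + 1) t l)
      (∑ l ∈ Finset.range L, population γp γm x N t l) fun n hn =>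
        Finset.sum_le_sum fun l _ => population_mono hγp hγm hx
          (Nat.succ_le_of_lt (Finset.mem_range.mp hn)) ht l
    simpa using this
  linarith

/-- Non-explosion for arbitrary initial data: truncating to finitely many levels costs `ε / 2`, and
the mass deficit, of order `1 / N`, costs the other half. -/
theorem eventually_population_mass (hγp : 0 ≤ γp) (hγm : 0 ≤ γm) {x : ℕ → ℝ}
    (hx : ∀ l, 0 ≤ x l) {m : ℝ} (hs : HasSum x m) {t : ℝ} (ht : 0 ≤ t) {ε : ℝ} (hε : 0 < ε) :
    ∀ᶠ N in atTop, m - ε ≤ ∑ l ∈ Finset.range N, population γp γm x N t l := by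
  obtain ⟨M, hM⟩ := (hs.tendsto_sum_nat.eventually
    (lt_mem_nhds (show m - ε / 2 < m by linarith))).exists
  set y : ℕ → ℝ := fun l => if l < M then x l else 0 with hy
  have hy0 : ∀ l, 0 ≤ y l := fun l => by simp only [hy]; split_ifs; exacts [hx l, le_rfl]
  have hyx : ∀ l, y l ≤ x l := fun l => by simp only [hy]; split_ifs; exacts [le_rfl, hx l]
  have hyM : ∀ l, M ≤ l → y l = 0 := fun l hl => by simp [hy, not_lt.mpr hl]
  have hsum : ∀ (w : ℕ → ℝ) (L : ℕ), M ≤ L → ∑ l ∈ Finset.range L, w l * y l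
      = ∑ l ∈ Finset.range M, w l * x l := by
    intro w L hL
    rw [← Finset.sum_subset (Finset.range_subset_range.mpr hL)]
    · exact Finset.sum_congr rfl fun l hl => by simp [hy, Finset.mem_range.mp hl]
    · intro l _ hl
      simp [hy, Finset.mem_range] at hl ⊢
      exact fun h => absurd h (not_lt.mpr hl)
  set K := (γp + γm) * (Real.exp (γp * t) * ∑ l ∈ Finset.range M, ((l : ℝ) + 1) * x l) * t
  obtain ⟨n, hn⟩ := exists_nat_gt (K / (ε / 2))
  set L := M + n + 1 with hL
  have hdef := population_mass_deficit hγp hγm hy0 hyM n (L := L) le_rfl ht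
  have h1 := hsum (fun _ => 1) L (by omega)
  simp only [one_mul] at h1
  rw [hsum (fun l => (l : ℝ) + 1) L (by omega), h1] at hdef
  have hlow : m - ε ≤ ∑ l ∈ Finset.range L, population γp γm y n t l := by
    rcases Nat.eq_zero_or_pos n with rfl | hn0
    · have hK : 0 ≤ K := mul_nonneg (mul_nonneg (by positivity) (mul_nonneg (Real.exp_nonneg _)
        (Finset.sum_nonneg fun l _ => mul_nonneg (by positivity) (hx l)))) ht
      have : 0 ≤ K / (ε / 2) := by positivity
      simp at hn
      linarith
    · have hn1 : (0 : ℝ) < n := by exact_mod_cast hn0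
      rw [div_lt_iff₀ (by positivity)] at hn
      have : ∑ l ∈ Finset.range M, x l - ∑ l ∈ Finset.range L, population γp γm y n t l
          ≤ ε / 2 := by
        by_contra hcon
        have := mul_lt_mul_of_pos_left (not_le.mp hcon) hn1
        linarith
      linarith
  filter_upwards [eventually_ge_atTop (max n L)] with N hN
  refine hlow.trans ?_
  calc ∑ l ∈ Finset.range L, population γp γm y n t l
      ≤ ∑ l ∈ Finset.range L, population γp γm x N t l := Finset.sum_le_sum fun l _ =>
        (population_mono_init hγp hγm hyx n ht l).trans
          (population_mono hγp hγm hx ((le_max_left _ _).trans hN) ht l)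
    _ ≤ _ := Finset.sum_le_sum_of_subset_of_nonneg
        (Finset.range_subset_range.mpr ((le_max_right _ _).trans hN))
        fun l _ _ => population_nonneg hγp hγm hx N ht l

theorem re_dyson_diag (X : ℕ → ℕ → ℂ) (n : ℕ) (t : ℝ) (l : ℕ) :
    (dyson γp γm X n t l l).re = population γp γm (fun l => (X l l).re) n t l := by
  induction n generalizing t l with
  | zero => simp [dyson, population]
  | succ n ih =>
    have hdec : decayRate γp γm l l = lossRate γp γm l := by simp [decayRate]
    have hint : IntervalIntegrable (fun s => (Real.exp (decayRate γp γm l l * s) : ℂ)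
        * gain γp γm (dyson γp γm X n s) l l) MeasureTheory.volume 0 t := by
      refine Continuous.intervalIntegrable ?_ _ _
      rw [← continuousOn_univ]
      exact continuousOn_duhamel_integrand
        (fun j k => (continuous_dyson _ _ j k).continuousOn) l l
    have h3 := Complex.reCLM.intervalIntegral_comp_comm hint
    simp only [Complex.reCLM_apply, Complex.re_ofReal_mul] at h3
    change (duhamel γp γm X (dyson γp γm X n) t l l).re = _
    simp only [duhamel, population, Complex.re_ofReal_mul, Complex.add_re]
    rw [← h3, hdec]
    congr 2
    refine intervalIntegral.integral_congr fun s _ => ?_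
    simp only [gain, Complex.add_re, Complex.re_ofReal_mul, ih, populationGain]
    have h1 : Real.sqrt l * Real.sqrt l = l := Real.mul_self_sqrt (by positivity)
    have h2 : Real.sqrt (l + 1) * Real.sqrt (l + 1) = (l : ℝ) + 1 :=
      Real.mul_self_sqrt (by positivity)
    rw [h1, h2]

end Occupation
end

/-! ### Orbits as solutions of the integrated master equation; trace inequalities. -/

noncomputable section

section Orbit

open ComplexConjugate
open scoped ComplexOrder

universe u

variable {H : Type u} [NormedAddCommGroup H] [InnerProductSpace ℂ H] [CompleteSpace H]
  {fock : HilbertBasis ℕ ℂ H} {γp γm : ℝ}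

/-- The matrix of an operator in the Fock basis. -/
def fockKernel (fock : HilbertBasis ℕ ℂ H) (ρ : H →L[ℂ] H) (j k : ℕ) : ℂ :=
  ⟪fock j, ρ (fock k)⟫_ℂ

/-- The matrix of `|x⟩⟨x|` in the Fock basis. -/
def pureKernel (fock : HilbertBasis ℕ ℂ H) (x : H) (j k : ℕ) : ℂ :=
  ⟪fock j, x⟫_ℂ * conj ⟪fock k, x⟫_ℂ

theorem matrixElement_single (ρ : H →L[ℂ] H) (j k : ℕ) (a b : ℂ) :
    matrixElement fock ρ (Finsupp.single j a) (Finsupp.single k b)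
      = conj a * b * fockKernel fock ρ j k := by
  simp only [matrixElement, Finsupp.linearCombination_single, map_smul, inner_smul_left,
    inner_smul_right, fockKernel]
  ring

theorem lindblad_single (ρ : H →L[ℂ] H) (m n : ℕ) :
    lindblad fock γp γm ρ (Finsupp.single m 1) (Finsupp.single n 1)
      = gain γp γm (fockKernel fock ρ) m n
        - (decayRate γp γm m n : ℂ) * fockKernel fock ρ m n := by
  have hac : ∀ m : ℕ, annihilate (create (Finsupp.single m 1))
      = Finsupp.single m ((m : ℂ) + 1) := by
    intro m
    simp only [annihilate, create, Finsupp.linearCombination_single, one_smul,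
      Finsupp.smul_single, smul_eq_mul, Nat.add_sub_cancel]
    rw [← Complex.ofReal_mul, Nat.cast_add, Nat.cast_one, Real.mul_self_sqrt (by positivity)]
    simp
  have hca : ∀ m : ℕ, create (annihilate (Finsupp.single m 1)) = Finsupp.single m (m : ℂ) := by
    intro m
    simp only [annihilate, create, Finsupp.linearCombination_single, one_smul,
      Finsupp.smul_single, smul_eq_mul]
    rcases m with _ | m
    · simp
    · rw [Nat.add_sub_cancel, ← Complex.ofReal_mul, Nat.cast_add, Nat.cast_one,
        Real.mul_self_sqrt (by positivity)]
      simp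
  have ha : ∀ m : ℕ, annihilate (Finsupp.single m 1)
      = Finsupp.single (m - 1) ((Real.sqrt m : ℝ) : ℂ) := by
    intro m; simp [annihilate]
  have hc : ∀ m : ℕ, create (Finsupp.single m 1)
      = Finsupp.single (m + 1) ((Real.sqrt (m + 1) : ℝ) : ℂ) := by
    intro m; simp [create]
  simp only [lindblad, lindbladPlus, lindbladMinus, hac, hca]
  simp only [ha, hc, matrixElement_single, gain, decayRate, lossRate, map_add, map_one, Complex.conj_ofReal, Complex.conj_natCast]
  push_cast
  ring

theorem IsOrbit.hasDerivWithinAt {r : ℝ → H →L[ℂ] H} (hr : IsOrbit fock γp γm r) (m n : ℕ) {t : ℝ}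
    (ht : 0 ≤ t) :
    HasDerivWithinAt (fun s => fockKernel fock (r s) m n)
      (gain γp γm (fockKernel fock (r t)) m n
        - (decayRate γp γm m n : ℂ) * fockKernel fock (r t) m n) (Set.Ici 0) t := by
  have h := hr.2 m n t ht
  rw [lindblad_single] at h
  simpa [matrixElement_single] using h

theorem IsOrbit.continuousOn {r : ℝ → H →L[ℂ] H} (hr : IsOrbit fock γp γm r) (m n : ℕ) :
    ContinuousOn (fun s => fockKernel fock (r s) m n) (Set.Ici 0) :=
  fun _ ht => (hr.hasDerivWithinAt m n ht).continuousWithinAt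

/-- Variation of constants: multiplying a matrix element by `e^{κ s}` removes its decay term and
leaves the gain as derivative. -/
theorem IsOrbit.eq_duhamel {r : ℝ → H →L[ℂ] H} (hr : IsOrbit fock γp γm r) {t : ℝ} (ht : 0 ≤ t) :
    fockKernel fock (r t)
      = duhamel γp γm (fockKernel fock (r 0)) (fun s => fockKernel fock (r s)) t := by
  ext j k
  set κ := decayRate γp γm j k with hκ
  have hexp : ∀ s : ℝ, HasDerivAt (fun s : ℝ => (Real.exp (κ * s) : ℂ))
      ((κ * Real.exp (κ * s) : ℝ) : ℂ) s := by
    intro s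
    have := (((hasDerivAt_id s).const_mul κ).exp).ofReal_comp
    simpa [mul_comm] using this
  have hcont : ContinuousOn (fun s : ℝ => (Real.exp (κ * s) : ℂ) * fockKernel fock (r s) j k)
      (Set.Icc 0 t) :=
    ContinuousOn.mul (by fun_prop) ((hr.continuousOn j k).mono Set.Icc_subset_Ici_self)
  have hderiv : ∀ s ∈ Set.Ioo 0 t, HasDerivWithinAt
      (fun s : ℝ => (Real.exp (κ * s) : ℂ) * fockKernel fock (r s) j k)
      ((Real.exp (κ * s) : ℂ) * gain γp γm (fockKernel fock (r s)) j k) (Set.Ioi s) s := by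
    intro s hs
    have h1 := (hr.hasDerivWithinAt j k hs.1.le).mono (Set.Ioi_subset_Ici hs.1.le)
    refine ((hexp s).hasDerivWithinAt.mul h1).congr_deriv ?_
    push_cast
    ring
  have h := intervalIntegral.integral_eq_sub_of_hasDeriv_right_of_le ht hcont hderiv
    (intervalIntegrable_duhamel hr.continuousOn ht j k)
  rw [duhamel, ← hκ, h]
  simp only [mul_zero, Real.exp_zero, Complex.ofReal_one, one_mul, add_sub_cancel]
  rw [← mul_assoc, ← Complex.ofReal_mul, ← Real.exp_add]
  simp

theorem qform_fockKernel (ρ : H →L[ℂ] H) (N : ℕ) (u : ℕ → ℂ) :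
    qform (fockKernel fock ρ) N u
      = (⟪∑ j ∈ Finset.range N, u j • fock j, ρ (∑ k ∈ Finset.range N, u k • fock k)⟫_ℂ).re := by
  rw [qform, sum_inner]
  congr 1
  refine Finset.sum_congr rfl fun j _ => ?_
  rw [inner_smul_left, map_sum, inner_sum, Finset.mul_sum]
  refine Finset.sum_congr rfl fun k _ => ?_
  rw [map_smul, inner_smul_right, fockKernel]
  ring

theorem posKernel_fockKernel {ρ : H →L[ℂ] H} (hρ : ρ.IsPositive) :
    PosKernel (fockKernel fock ρ) := fun N u => by
  rw [qform_fockKernel]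
  exact (Complex.nonneg_iff.mp (hρ.inner_nonneg_right _)).1

theorem qform_pureKernel (x : H) (N : ℕ) (u : ℕ → ℂ) :
    qform (pureKernel fock x) N u = ‖⟪x, ∑ k ∈ Finset.range N, u k • fock k⟫_ℂ‖ ^ 2 := by
  have h := qform_rankOne (fun j => ⟪fock j, x⟫_ℂ) N u
  change qform (fun j k => ⟪fock j, x⟫_ℂ * conj ⟪fock k, x⟫_ℂ) N u = _
  rw [h]
  simp only [inner_sum, inner_smul_right, inner_conj_symm, mul_comm]

theorem norm_sum_smul_fock_sq (N : ℕ) (u : ℕ → ℂ) :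
    ‖∑ k ∈ Finset.range N, u k • fock k‖ ^ 2 = ∑ k ∈ Finset.range N, ‖u k‖ ^ 2 := by
  have h := fock.orthonormal.inner_sum u u (Finset.range N)
  rw [inner_self_eq_norm_sq_to_K] at h
  have h2 := congrArg Complex.re h
  rw [Complex.re_sum] at h2
  simp only [← Complex.normSq_eq_conj_mul_self, Complex.ofReal_re, Complex.normSq_eq_norm_sq] at h2
  rw [← h2]
  norm_cast

theorem tendsto_sum_inner_smul_fock (x : H) :
    Tendsto (fun N => ∑ k ∈ Finset.range N, ⟪fock k, x⟫_ℂ • fock k) atTop (𝓝 x) := by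
  have h := (fock.hasSum_repr x).tendsto_sum_nat
  simpa only [HilbertBasis.repr_apply_apply] using h

theorem tendsto_qform_fockKernel (ρ : H →L[ℂ] H) (x : H) :
    Tendsto (fun N => qform (fockKernel fock ρ) N fun l => ⟪fock l, x⟫_ℂ) atTop
      (𝓝 (⟪x, ρ x⟫_ℂ).re) := by
  simp only [qform_fockKernel]
  have h := tendsto_sum_inner_smul_fock (fock := fock) x
  exact (Complex.continuous_re.tendsto _).comp (h.inner ((ρ.continuous.tendsto x).comp h))

/-- The hypothesis says that `W`, the matrix `c` minus a sum of rank-one terms, is positive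
semidefinite. Splitting `W` into rank-one terms expresses the trace of `X` against `W` as a sum of
values of the form of `X`, hence nonnegative. -/
theorem PosKernel.sum_qform_le_trace {X : ℕ → ℕ → ℂ} (hX : PosKernel X) {ι : Type*} (G : Finset ι)
    (N : ℕ) (u : ι → ℕ → ℂ) {c : ℝ}
    (hu : ∀ x : ℕ → ℂ, ∑ i ∈ G, ‖∑ k ∈ Finset.range N, u i k * x k‖ ^ 2
      ≤ c * ∑ k ∈ Finset.range N, ‖x k‖ ^ 2) :
    ∑ i ∈ G, qform X N (u i) ≤ c * ∑ l ∈ Finset.range N, (X l l).re := by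
  set W : Matrix (Fin N) (Fin N) ℂ := fun j k =>
    (if j = k then (c : ℂ) else 0) - ∑ i ∈ G, conj (u i j) * u i k with hW
  have hWpos : W.PosSemidef := by
    refine Matrix.PosSemidef.of_dotProduct_mulVec_nonneg ?_ fun x => ?_
    · ext j k
      change conj (W k j) = W j k
      simp only [hW, map_sub, map_sum, map_mul, Complex.conj_conj]
      congr 1
      · by_cases h : j = k
        · subst h; simp
        · simp [h, Ne.symm h]
      · exact Finset.sum_congr rfl fun i _ => mul_comm _ _
    · set y : ℕ → ℂ := fun k => if h : k < N then x ⟨k, h⟩ else 0 with hy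
      have hyx : ∀ k : Fin N, y k = x k := fun k => by simp [hy]
      have h := hu y
      rw [← Fin.sum_univ_eq_sum_range (fun k => ‖y k‖ ^ 2)] at h
      simp only [← Fin.sum_univ_eq_sum_range (fun k => u _ k * y k), hyx] at h
      have heq : star x ⬝ᵥ W.mulVec x = ((c * ∑ k, ‖x k‖ ^ 2
          - ∑ i ∈ G, ‖∑ k : Fin N, u i k * x k‖ ^ 2 : ℝ) : ℂ) := by
        simp only [dotProduct, Matrix.mulVec, hW, sub_mul, Finset.sum_sub_distrib, mul_sub,
          ite_mul, zero_mul, Finset.sum_ite_eq, Finset.mem_univ, if_true, Pi.star_apply,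
          RCLike.star_def]
        push_cast
        congr 1
        · rw [Finset.mul_sum]
          refine Finset.sum_congr rfl fun k _ => ?_
          rw [← Complex.conj_mul']
          ring
        · simp only [← Complex.conj_mul', map_sum, map_mul, Finset.sum_mul_sum]
          rw [Finset.sum_comm (s := G)]
          refine Finset.sum_congr rfl fun j _ => ?_
          rw [Finset.sum_comm (s := G), Finset.mul_sum]
          refine Finset.sum_congr rfl fun k _ => ?_
          rw [Finset.sum_mul, Finset.mul_sum]
          refine Finset.sum_congr rfl fun i _ => ?_
          ring
      rw [heq]
      exact_mod_cast sub_nonneg.mpr h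
  obtain ⟨m, v, hv⟩ := Matrix.posSemidef_iff_eq_sum_vecMulVec.mp hWpos
  set z : Fin m → ℕ → ℂ := fun a k => if h : k < N then conj (v a ⟨k, h⟩) else 0
    with hz
  have hzv : ∀ a (k : Fin N), z a k = conj (v a k) := fun a k => by simp [hz]
  have hq : ∀ w : ℕ → ℂ, qform X N w = (∑ j : Fin N, ∑ k : Fin N, conj (w j) * X j k * w k).re := by
    intro w
    rw [qform, ← Fin.sum_univ_eq_sum_range
      (fun j => ∑ k ∈ Finset.range N, conj (w j) * X j k * w k)]
    simp only [← Fin.sum_univ_eq_sum_range (fun k => conj (w _) * X _ k * w k)]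
  have h1 : ∑ a, qform X N (z a) = (∑ j : Fin N, ∑ k : Fin N, X j k * W j k).re := by
    have hW2 : ∀ j k, W j k = ∑ a, v a j * conj (v a k) := fun j k => by
      rw [hv, Matrix.sum_apply]
      rfl
    simp only [hq, ← Complex.re_sum, hW2, hzv, Complex.conj_conj, Finset.mul_sum]
    congr 1
    rw [Finset.sum_comm]
    refine Finset.sum_congr rfl fun j _ => ?_
    rw [Finset.sum_comm]
    refine Finset.sum_congr rfl fun k _ => Finset.sum_congr rfl fun a _ => ?_
    ring
  have h2 : (∑ j : Fin N, ∑ k : Fin N, X j k * W j k).re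
      = c * ∑ l ∈ Finset.range N, (X l l).re - ∑ i ∈ G, qform X N (u i) := by
    simp only [hW, mul_sub, Finset.sum_sub_distrib, Complex.sub_re, mul_ite, mul_zero,
      Finset.sum_ite_eq, Finset.mem_univ, if_true]
    congr 1
    · rw [← Fin.sum_univ_eq_sum_range (fun l => (X l l).re), Complex.re_sum, Finset.mul_sum]
      refine Finset.sum_congr rfl fun l _ => ?_
      rw [mul_comm, Complex.re_ofReal_mul]
    · simp only [hq, ← Complex.re_sum, Finset.mul_sum]
      congr 1
      rw [Finset.sum_comm (s := G)]
      refine Finset.sum_congr rfl fun j _ => ?_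
      rw [Finset.sum_comm (s := G)]
      refine Finset.sum_congr rfl fun k _ => Finset.sum_congr rfl fun a _ => ?_
      ring
  have h3 : 0 ≤ ∑ a, qform X N (z a) := Finset.sum_nonneg fun a _ => hX _ _
  linarith

/-- Bessel's inequality supplies the constant `1`. -/
theorem PosKernel.sum_qform_orthonormal_le_trace {X : ℕ → ℕ → ℂ} (hX : PosKernel X) {ι : Type*}
    {e : ι → H} (he : Orthonormal ℂ e) (G : Finset ι) (N : ℕ) :
    ∑ i ∈ G, qform X N (fun l => ⟪fock l, e i⟫_ℂ) ≤ ∑ l ∈ Finset.range N, (X l l).re := by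
  refine (hX.sum_qform_le_trace G N _ (c := 1) fun x => ?_).trans_eq (one_mul _)
  have h := he.sum_inner_products_le (∑ k ∈ Finset.range N, conj (x k) • fock k) (s := G)
  rw [norm_sum_smul_fock_sq] at h
  simp only [RCLike.norm_conj] at h
  rw [one_mul]
  refine le_trans (le_of_eq (Finset.sum_congr rfl fun i _ => ?_)) h
  rw [norm_inner_symm]
  simp only [sum_inner, inner_smul_left, Complex.conj_conj, mul_comm]

theorem PosKernel.qform_le_trace {X : ℕ → ℕ → ℂ} (hX : PosKernel X) (N : ℕ) (u : ℕ → ℂ) :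
    qform X N u ≤ (∑ k ∈ Finset.range N, ‖u k‖ ^ 2) * ∑ l ∈ Finset.range N, (X l l).re := by
  have h := hX.sum_qform_le_trace (Finset.univ : Finset Unit) N (fun _ => u)
    (c := ∑ k ∈ Finset.range N, ‖u k‖ ^ 2) fun x => by
      simp only [Finset.univ_unique, Finset.sum_singleton]
      calc ‖∑ k ∈ Finset.range N, u k * x k‖ ^ 2
          ≤ (∑ k ∈ Finset.range N, ‖u k‖ * ‖x k‖) ^ 2 := by
            gcongr
            refine (norm_sum_le _ _).trans_eq ?_
            simp only [norm_mul]
        _ ≤ _ := Finset.sum_mul_sq_le_sq_mul_sq _ _ _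
  simpa using h

theorem PosKernel.diag_nonneg {X : ℕ → ℕ → ℂ} (hX : PosKernel X) (l : ℕ) : 0 ≤ (X l l).re := by
  have h := hX (l + 1) (Pi.single l 1)
  simpa [qform, Pi.single_apply, Finset.sum_ite_eq] using h

end Orbit
end

/-! ### The transition matrix, the one-sided entropy bound and uniqueness of orbits. -/

noncomputable section

section Transition

open ComplexConjugate
open scoped ComplexOrder

universe u

variable {H : Type u} [NormedAddCommGroup H] [InnerProductSpace ℂ H] [CompleteSpace H]
  {fock : HilbertBasis ℕ ℂ H} {γp γm : ℝ}

theorem IsDensity.sum_diag_le_one {ρ : H →L[ℂ] H} (h : IsDensity fock ρ) (N : ℕ) :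
    ∑ l ∈ Finset.range N, (fockKernel fock ρ l l).re ≤ 1 := by
  have h1 := Complex.hasSum_re h.2
  exact sum_le_hasSum _ (fun l _ => (posKernel_fockKernel h.1).diag_nonneg l) h1

theorem IsOrbit.posKernel_sub_dyson (hγp : 0 ≤ γp) (hγm : 0 ≤ γm) {r : ℝ → H →L[ℂ] H}
    (hr : IsOrbit fock γp γm r) {X : ℕ → ℕ → ℂ}
    (hX : PosKernel fun j k => fockKernel fock (r 0) j k - X j k) (n : ℕ) {t : ℝ} (ht : 0 ≤ t) :
    PosKernel fun j k => fockKernel fock (r t) j k - dyson γp γm X n t j k :=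
  _root_.posKernel_sub_dyson (Y := fun s => fockKernel fock (r s)) hγp hγm hr.continuousOn
    (fun _ hs => hr.eq_duhamel hs) (fun s hs => posKernel_fockKernel (hr.1 s hs).1) hX n ht

/-- If the matrix `X` has trace `m`, then the part of an orbit not accounted for by the
Dyson series of `X` has trace at most `1 - m`, up to any given error. -/
theorem IsOrbit.eventually_trace_sub_dyson_le (hγp : 0 ≤ γp) (hγm : 0 ≤ γm) {r : ℝ → H →L[ℂ] H}
    (hr : IsOrbit fock γp γm r) {X : ℕ → ℕ → ℂ} (hX : ∀ l, 0 ≤ (X l l).re) {m : ℝ}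
    (hm : HasSum (fun l => (X l l).re) m) {t : ℝ} (ht : 0 ≤ t) {ε : ℝ} (hε : 0 < ε) :
    ∀ᶠ N in atTop, ∑ l ∈ Finset.range N,
      (fockKernel fock (r t) l l - dyson γp γm X N t l l).re ≤ 1 - m + ε := by
  filter_upwards [eventually_population_mass hγp hγm hX hm ht hε] with N hN
  simp only [Complex.sub_re, Finset.sum_sub_distrib, re_dyson_diag]
  have := (hr.1 t ht).sum_diag_le_one N
  linarith

theorem re_pureKernel_diag (x : H) (l : ℕ) : (pureKernel fock x l l).re = ‖⟪fock l, x⟫_ℂ‖ ^ 2 := by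
  rw [pureKernel, mul_comm, ← Complex.normSq_eq_conj_mul_self, Complex.ofReal_re,
    Complex.normSq_eq_norm_sq]

theorem posKernel_one_sub_sum_pureKernel {ι : Type*} {f : ι → H} (hf : Orthonormal ℂ f)
    (F : Finset ι) :
    PosKernel fun j k => (if j = k then 1 else 0) - ∑ i ∈ F, pureKernel fock (f i) j k := by
  intro N u
  rw [qform_sub (fun j k => if j = k then 1 else 0) _ N u, qform_sum]
  have h1 : qform (fun j k => if j = k then 1 else 0) N u
      = ‖∑ k ∈ Finset.range N, u k • fock k‖ ^ 2 := by
    have h := qform_expIdentity (γp := 0) (γm := 0) 0 N u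
    have h2 : expIdentity 0 0 0 = fun j k => if j = k then 1 else 0 := by
      ext j k; simp [expIdentity]
    rw [norm_sum_smul_fock_sq, ← h2, h]
    simp
  simp only [h1, qform_pureKernel]
  exact sub_nonneg.mpr (hf.sum_inner_products_le _)

/-- A finite part of the spectral decomposition lies below `ρ`, so its Dyson series can be compared
with the orbit from `ρ`. -/
theorem posKernel_sub_sum_pureKernel {ρ : H →L[ℂ] H} (hρ : IsSelfAdjoint ρ) {ι : Type*}
    (f : HilbertBasis ι ℂ H) {p : ι → ℝ} (hf : ∀ i, ρ (f i) = (p i : ℂ) • f i)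
    (hp : ∀ i, 0 ≤ p i) (F : Finset ι) :
    PosKernel fun j k => fockKernel fock ρ j k - ∑ i ∈ F, (p i : ℂ) * pureKernel fock (f i) j k := by
  intro N u
  rw [qform_sub, qform_sum F (fun i j k => (p i : ℂ) * pureKernel fock (f i) j k)]
  simp only [qform_smul, qform_pureKernel, qform_fockKernel]
  exact sub_nonneg.mpr (sum_le_hasSum F (fun i _ => mul_nonneg (hp i) (by positivity))
    (hasSum_eigenvalue_mul_norm_sq hρ f hf _))

/-- The transition matrix between the eigenbases of the initial and the final state of an orbit. -/
theorem IsOrbit.exists_transition (hγp : 0 ≤ γp) (hγm : 0 ≤ γm) {r : ℝ → H →L[ℂ] H}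
    (hr : IsOrbit fock γp γm r) {t : ℝ} (ht : 0 ≤ t) {ι κ : Type*} (e : HilbertBasis ι ℂ H)
    (f : HilbertBasis κ ℂ H) {q : ι → ℝ} {p : κ → ℝ}
    (he : ∀ i, r t (e i) = (q i : ℂ) • e i) (hf : ∀ i, r 0 (f i) = (p i : ℂ) • f i)
    (hp : ∀ i, 0 ≤ p i) :
    ∃ T : ι → κ → ℝ, (∀ i j, 0 ≤ T i j) ∧
      (∀ i (F : Finset κ), ∑ j ∈ F, T i j ≤ Real.exp ((γm - γp) * t)) ∧
      (∀ i (F : Finset κ), ∑ j ∈ F, p j * T i j ≤ q i) ∧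
      ∀ (G : Finset ι) (F : Finset κ),
        ∑ i ∈ G, (q i - ∑ j ∈ F, p j * T i j) ≤ 1 - ∑ j ∈ F, p j := by
  set c := Real.exp ((γm - γp) * t) with hc
  set u : ι → ℕ → ℂ := fun i l => ⟪fock l, e i⟫_ℂ with hu
  have hu1 : ∀ i N, ∑ l ∈ Finset.range N, ‖u i l‖ ^ 2 ≤ 1 := by
    intro i N
    have := fock.orthonormal.sum_inner_products_le (e i) (s := Finset.range N)
    rwa [e.orthonormal.1 i, one_pow] at this
  -- Approximates `⟨e_i|Φ_t(|f_j⟩⟨f_j|)|e_i⟩`; the same `N` cuts off the Dyson series and the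
  -- coordinates.
  set A : ℕ → ι → κ → ℝ := fun N i j =>
    qform (dyson γp γm (pureKernel fock (f j)) N t) N (u i) with hA
  set Q : ℕ → ι → ℝ := fun N i => qform (fockKernel fock (r t)) N (u i) with hQ
  have hpure : ∀ x : H, PosKernel (pureKernel fock x) := fun x N w => by
    rw [qform_pureKernel]; positivity
  have hA0 : ∀ N i j, 0 ≤ A N i j := fun N i j => (hpure _).dyson hγp hγm N ht N _
  have hAc : ∀ N i (F : Finset κ), ∑ j ∈ F, A N i j ≤ c := by
    intro N i F
    have h := qform_dyson_le hγp hγm (posKernel_one_sub_sum_pureKernel (fock := fock)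
      f.orthonormal F) N N ht (u i)
    rw [dyson_sum, qform_sum F (fun j => dyson γp γm (pureKernel fock (f j)) N t)] at h
    exact h.trans (mul_le_of_le_one_right (Real.exp_nonneg _) (hu1 i N))
  set X : Finset κ → ℕ → ℕ → ℂ := fun F j k => ∑ i ∈ F, (p i : ℂ) * pureKernel fock (f i) j k
  have hXq : ∀ F N i, qform (dyson γp γm (X F) N t) N (u i) = ∑ j ∈ F, p j * A N i j := by
    intro F N i
    rw [dyson_sum, qform_sum F (fun i => dyson γp γm
      (fun j k => (p i : ℂ) * pureKernel fock (f i) j k) N t)]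
    refine Finset.sum_congr rfl fun j _ => ?_
    rw [dyson_smul, qform_smul]
  have hpos : ∀ F N, PosKernel fun j k =>
      fockKernel fock (r t) j k - dyson γp γm (X F) N t j k := fun F N =>
    hr.posKernel_sub_dyson hγp hγm
      (posKernel_sub_sum_pureKernel (hr.1 0 le_rfl).1.isSelfAdjoint f hf hp F) N ht
  have hAQ : ∀ N i (F : Finset κ), ∑ j ∈ F, p j * A N i j ≤ Q N i := by
    intro N i F
    have h := hpos F N N (u i)
    rw [qform_sub, hXq] at h
    linarith
  have hGF : ∀ (G : Finset ι) (F : Finset κ) (ε : ℝ), 0 < ε → ∀ᶠ N in atTop,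
      ∑ i ∈ G, (Q N i - ∑ j ∈ F, p j * A N i j) ≤ 1 - ∑ j ∈ F, p j + ε := by
    intro G F ε hε
    have hdiag : ∀ l, (X F l l).re = ∑ j ∈ F, p j * ‖⟪fock l, f j⟫_ℂ‖ ^ 2 := by
      intro l
      simp only [X, Complex.re_sum, Complex.re_ofReal_mul, re_pureKernel_diag]
    have hsum : HasSum (fun l => (X F l l).re) (∑ j ∈ F, p j) := by
      simp only [hdiag]
      refine hasSum_sum fun j _ => ?_
      have := (fock.hasSum_norm_inner_sq (f j)).mul_left (p j)
      rwa [f.orthonormal.1 j, one_pow, mul_one] at this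
    have hnn : ∀ l, 0 ≤ (X F l l).re := fun l => by
      rw [hdiag]
      exact Finset.sum_nonneg fun j _ => mul_nonneg (hp j) (by positivity)
    filter_upwards [hr.eventually_trace_sub_dyson_le hγp hγm hnn hsum ht hε] with N hN
    refine le_trans ?_ hN
    refine le_trans (le_of_eq ?_)
      ((hpos F N).sum_qform_orthonormal_le_trace (fock := fock) e.orthonormal G N)
    refine Finset.sum_congr rfl fun i _ => ?_
    rw [qform_sub, hXq]
  have hQlim : ∀ i, Tendsto (fun N => Q N i) atTop (𝓝 (q i)) := by
    intro i
    have h := tendsto_qform_fockKernel (fock := fock) (r t) (e i)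
    rw [he, inner_smul_right, inner_self_eq_norm_sq_to_K, e.orthonormal.1 i] at h
    simpa using h
  -- The entries lie in `[0, c]`, so they converge along an ultrafilter. The four properties are
  -- closed conditions on finitely many entries and pass to this limit.
  have hlim : ∀ i j, ∃ x, Tendsto (fun N => A N i j) (hyperfilter ℕ) (𝓝 x) := by
    intro i j
    obtain ⟨x, -, hx⟩ := (isCompact_Icc (a := (0 : ℝ)) (b := c)).ultrafilter_le_nhds
      ((hyperfilter ℕ).map fun N => A N i j) (by
        rw [Ultrafilter.coe_map, le_principal_iff, mem_map]
        refine Eventually.of_forall fun N => ⟨hA0 N i j, ?_⟩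
        simpa using hAc N i {j})
    exact ⟨x, hx⟩
  choose T hT using hlim
  have hle := Nat.hyperfilter_le_atTop
  refine ⟨T, fun i j => ge_of_tendsto (hT i j) (Eventually.of_forall fun N => hA0 N i j),
    fun i F => le_of_tendsto (tendsto_finsetSum F fun j _ => hT i j)
      (Eventually.of_forall fun N => hAc N i F),
    fun i F => le_of_tendsto_of_tendsto
      (tendsto_finsetSum F fun j _ => (hT i j).const_mul (p j)) ((hQlim i).mono_left hle)
      (Eventually.of_forall fun N => hAQ N i F), fun G F => ?_⟩
  refine le_of_forall_pos_le_add fun ε hε => ?_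
  exact le_of_tendsto (tendsto_finsetSum G fun i _ => ((hQlim i).mono_left hle).sub
    (tendsto_finsetSum F fun j _ => (hT i j).const_mul (p j))) (hle (hGF G F ε hε))

/-- The graph of the concave function `-p ln p` lies below its tangent at `x`. -/
theorem Real.negMulLog_le_sub {p x : ℝ} (hp : 0 ≤ p) (hx : 0 < x) :
    Real.negMulLog p ≤ -p * Real.log x - p + x := by
  rcases hp.eq_or_lt with rfl | hp
  · simpa using hx.le
  · have h := Real.log_le_sub_one_of_pos (div_pos hx hp)
    rw [Real.log_div hx.ne' hp.ne'] at h
    have h2 := mul_le_mul_of_nonneg_left h hp.le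
    have h3 : p * (x / p - 1) = x - p := by field_simp
    rw [h3] at h2
    rw [Real.negMulLog]
    linarith

/-- Entropy inequality for a transition matrix whose row sums are at most `e^a`. -/
theorem tsum_negMulLog_le_of_transition {ι κ : Type*} {q : ι → ℝ} {p : κ → ℝ}
    (hq : HasSum q 1) (hp : HasSum p 1) (hp0 : ∀ j, 0 ≤ p j)
    (hnq : ∀ i, 0 ≤ Real.negMulLog (q i)) (hnp : ∀ j, 0 ≤ Real.negMulLog (p j))
    {T : ι → κ → ℝ} {a : ℝ} (ha : 0 ≤ a) (hT : ∀ i j, 0 ≤ T i j)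
    (hrow : ∀ i (F : Finset κ), ∑ j ∈ F, T i j ≤ Real.exp a)
    (hle : ∀ i (F : Finset κ), ∑ j ∈ F, p j * T i j ≤ q i)
    (hge : ∀ (G : Finset ι) (F : Finset κ),
      ∑ i ∈ G, (q i - ∑ j ∈ F, p j * T i j) ≤ 1 - ∑ j ∈ F, p j) :
    ∑' j, ENNReal.ofReal (Real.negMulLog (p j))
      ≤ ∑' i, ENNReal.ofReal (Real.negMulLog (q i)) + ENNReal.ofReal a := by
  -- The empty set of indices gives nonnegativity.
  have hq0 : ∀ i, 0 ≤ q i := fun i => by simpa using hle i ∅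
  -- With `G = {i}` and `F` exhausting the index set, the trace inequality says that no part of `q
  -- i` is missing.
  have hsum : ∀ i, HasSum (fun j => p j * T i j) (q i) := by
    intro i
    have hs : Summable fun j => p j * T i j :=
      summable_of_sum_le (fun j => mul_nonneg (hp0 j) (hT i j)) (hle i)
    have h1 : ∀ F : Finset κ, q i - ∑ j ∈ F, p j * T i j ≤ 1 - ∑ j ∈ F, p j := fun F => by
      simpa using hge {i} F
    have h2 : q i - ∑' j, p j * T i j ≤ 1 - 1 :=
      le_of_tendsto_of_tendsto' (tendsto_const_nhds.sub hs.hasSum) (tendsto_const_nhds.sub hp) h1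
    have h3 : ∑' j, p j * T i j ≤ q i := hs.tsum_le_of_sum_le (hle i)
    have : ∑' j, p j * T i j = q i := by linarith
    exact this ▸ hs.hasSum
  -- The opposite choice, `F = {j}` and `G` exhausting the index set: trace preservation for the
  -- `j`-th eigenvector.
  have hcol : ∀ j, p j ≠ 0 → 1 ≤ ∑' i, ENNReal.ofReal (T i j) := by
    intro j hj
    have hpj : 0 < p j := (hp0 j).lt_of_ne' hj
    have h1 : ∀ G : Finset ι, ∑ i ∈ G, q i - (1 - p j) ≤ p j * ∑ i ∈ G, T i j := fun G => by
      have := hge G {j}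
      simp only [Finset.sum_singleton, Finset.sum_sub_distrib, ← Finset.mul_sum] at this
      linarith
    have h2 : ∀ G : Finset ι, ENNReal.ofReal ((∑ i ∈ G, q i - (1 - p j)) / p j)
        ≤ ∑' i, ENNReal.ofReal (T i j) := fun G => by
      refine le_trans ?_ (ENNReal.sum_le_tsum G)
      rw [← ENNReal.ofReal_sum_of_nonneg fun i _ => hT i j]
      refine ENNReal.ofReal_le_ofReal ?_
      rw [div_le_iff₀ hpj, mul_comm]
      exact h1 G
    have h3 : Tendsto (fun G : Finset ι => ENNReal.ofReal ((∑ i ∈ G, q i - (1 - p j)) / p j)) atTop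
        (𝓝 (ENNReal.ofReal ((1 - (1 - p j)) / p j))) := by
      have hq' : Tendsto (fun G : Finset ι => ∑ i ∈ G, q i) atTop (𝓝 1) := hq
      exact (ENNReal.continuous_ofReal.tendsto _).comp
        ((hq'.sub_const (1 - p j)).div_const (p j))
    have h4 := le_of_tendsto' h3 h2
    rwa [sub_sub_cancel, div_self hj, ENNReal.ofReal_one] at h4
  have hlocal : ∀ i, ∑' j, ENNReal.ofReal (T i j * Real.negMulLog (p j))
      ≤ ENNReal.ofReal (Real.negMulLog (q i)) + ENNReal.ofReal (a * q i) := by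
    intro i
    rw [← ENNReal.ofReal_add (hnq i) (mul_nonneg ha (hq0 i))]
    rcases (hq0 i).eq_or_lt with h0 | h0
    · have hz : ∀ j, T i j * Real.negMulLog (p j) = 0 := by
        intro j
        have h1 := hle i {j}
        rw [Finset.sum_singleton, ← h0] at h1
        have h2 : p j * T i j = 0 := le_antisymm h1 (mul_nonneg (hp0 j) (hT i j))
        rcases mul_eq_zero.mp h2 with h | h <;> simp [h]
      simp [hz]
    -- The tangent point is the weighted mean of the `p j` as if the row sum were exactly `e^a`. The
    -- surplus `x ∑ T i j` is then at most `q i`, and the logarithm contributes `a * q i`.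
    · set x := q i / Real.exp a with hx
      have hx0 : 0 < x := div_pos h0 (Real.exp_pos a)
      have hlog : Real.log x = Real.log (q i) - a := by
        rw [hx, Real.log_div h0.ne' (Real.exp_pos a).ne', Real.log_exp]
      have hB : ∀ F : Finset κ, ∑ j ∈ F, T i j * Real.negMulLog (p j)
          ≤ (-Real.log x - 1) * ∑ j ∈ F, p j * T i j + q i := by
        intro F
        have h1 : ∑ j ∈ F, T i j * Real.negMulLog (p j)
            ≤ ∑ j ∈ F, ((-Real.log x - 1) * (p j * T i j) + x * T i j) :=
          Finset.sum_le_sum fun j _ => by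
            have := mul_le_mul_of_nonneg_left (Real.negMulLog_le_sub (hp0 j) hx0) (hT i j)
            linarith
        rw [Finset.sum_add_distrib, ← Finset.mul_sum, ← Finset.mul_sum] at h1
        have h2 : x * ∑ j ∈ F, T i j ≤ q i := by
          refine (mul_le_mul_of_nonneg_left (hrow i F) hx0.le).trans_eq ?_
          rw [hx, div_mul_cancel₀ _ (Real.exp_pos a).ne']
        linarith
      have hlim : Tendsto (fun F : Finset κ => (-Real.log x - 1) * ∑ j ∈ F, p j * T i j + q i) atTop
          (𝓝 (Real.negMulLog (q i) + a * q i)) := by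
        have hs : Tendsto (fun F : Finset κ => ∑ j ∈ F, p j * T i j) atTop (𝓝 (q i)) := hsum i
        have h := (hs.const_mul (-Real.log x - 1)).add_const (q i)
        convert h using 2
        rw [Real.negMulLog, hlog]
        ring
      have hS : Tendsto (fun F : Finset κ => ∑ j ∈ F,
          ENNReal.ofReal (T i j * Real.negMulLog (p j))) atTop
          (𝓝 (∑' j, ENNReal.ofReal (T i j * Real.negMulLog (p j)))) := ENNReal.summable.hasSum
      refine le_of_tendsto_of_tendsto' hS ((ENNReal.continuous_ofReal.tendsto _).comp hlim)
        fun F => ?_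
      rw [← ENNReal.ofReal_sum_of_nonneg fun j _ => mul_nonneg (hT i j) (hnp j)]
      exact ENNReal.ofReal_le_ofReal (hB F)
  calc ∑' j, ENNReal.ofReal (Real.negMulLog (p j))
      ≤ ∑' j, (∑' i, ENNReal.ofReal (T i j)) * ENNReal.ofReal (Real.negMulLog (p j)) := by
        refine ENNReal.tsum_le_tsum fun j => ?_
        by_cases hj : p j = 0
        · simp [hj]
        · exact le_mul_of_one_le_left' (hcol j hj)
    _ = ∑' i, ∑' j, ENNReal.ofReal (T i j * Real.negMulLog (p j)) := by
        simp only [ENNReal.ofReal_mul (hT _ _), ← ENNReal.tsum_mul_right]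
        rw [ENNReal.tsum_comm]
    _ ≤ ∑' i, (ENNReal.ofReal (Real.negMulLog (q i)) + ENNReal.ofReal (a * q i)) :=
        ENNReal.tsum_le_tsum hlocal
    _ = _ := by
        rw [ENNReal.tsum_add]
        congr 1
        rw [← ENNReal.ofReal_tsum_of_nonneg (fun i => mul_nonneg ha (hq0 i))
          (hq.summable.mul_left a), tsum_mul_left, hq.tsum_eq, mul_one]

theorem IsOrbit.vnEntropy_zero_le (hγp : 0 ≤ γp) (hγm : 0 ≤ γm) {r : ℝ → H →L[ℂ] H}
    (hr : IsOrbit fock γp γm r) {t : ℝ} (ht : 0 ≤ t) :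
    vnEntropy fock (r 0) ≤ vnEntropy fock (r t) + ENNReal.ofReal (|γm - γp| * t) := by
  obtain ⟨ι, e, q, he, hq0, hnq, hq, hSq⟩ := (hr.1 t ht).exists_spectral
  obtain ⟨κ, f, p, hf, hp0, hnp, hp, hSp⟩ := (hr.1 0 le_rfl).exists_spectral
  obtain ⟨T, hT, hrow, hle, hge⟩ := hr.exists_transition hγp hγm ht e f he hf hp0
  rw [hSq, hSp]
  -- The absolute value makes the exponent nonnegative, as the entropy inequality requires, whatever
  -- the sign of `γ₋ - γ₊`.
  refine tsum_negMulLog_le_of_transition hq hp hp0 hnq hnp (by positivity) hT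
    (fun i F => (hrow i F).trans (Real.exp_le_exp.mpr ?_)) hle hge
  exact mul_le_mul_of_nonneg_right (le_abs_self _) ht

theorem IsOrbit.shift {r : ℝ → H →L[ℂ] H} (hr : IsOrbit fock γp γm r) {t : ℝ} (ht : 0 ≤ t) :
    IsOrbit fock γp γm fun s => r (t + s) := by
  refine ⟨fun s hs => hr.1 _ (add_nonneg ht hs), fun m n s hs => ?_⟩
  have h := hr.2 m n (t + s) (add_nonneg ht hs)
  have h2 : HasDerivWithinAt (fun s => t + s) 1 (Set.Ici 0) s :=
    ((hasDerivAt_id s).const_add t).hasDerivWithinAt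
  have h3 := HasDerivWithinAt.scomp (t' := Set.Ici 0) s h h2 fun x hx => add_nonneg ht hx
  simpa [Function.comp_def] using h3

theorem IsOrbit.vnEntropy_le (hγp : 0 ≤ γp) (hγm : 0 ≤ γm) {r : ℝ → H →L[ℂ] H}
    (hr : IsOrbit fock γp γm r) {s t : ℝ} (hs : 0 ≤ s) (hst : s ≤ t) :
    vnEntropy fock (r s) ≤ vnEntropy fock (r t) + ENNReal.ofReal (|γm - γp| * (t - s)) := by
  simpa using (hr.shift hs).vnEntropy_zero_le hγp hγm (sub_nonneg.mpr hst)

/-- Both orbits dominate the Dyson sums of the same initial state. Non-explosion drives the trace of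
the positive remainder to zero, and a form is bounded by a trace, so both equal the limit of the
Dyson sums. -/
theorem IsOrbit.eq_of_zero_eq (hγp : 0 ≤ γp) (hγm : 0 ≤ γm) {r r' : ℝ → H →L[ℂ] H}
    (hr : IsOrbit fock γp γm r) (hr' : IsOrbit fock γp γm r') (h0 : r 0 = r' 0) {t : ℝ}
    (ht : 0 ≤ t) : r t = r' t := by
  set X := fockKernel fock (r 0) with hX
  have hXX : PosKernel fun j k => X j k - X j k := fun N u => by simp [qform]
  have hXpos : ∀ l, 0 ≤ (X l l).re := (posKernel_fockKernel (hr.1 0 le_rfl).1).diag_nonneg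
  have hXsum : HasSum (fun l => (X l l).re) 1 := Complex.hasSum_re (hr.1 0 le_rfl).2
  have key : ∀ r : ℝ → H →L[ℂ] H, IsOrbit fock γp γm r → fockKernel fock (r 0) = X →
      ∀ N u, Tendsto (fun n => qform (dyson γp γm X n t) N u) atTop
        (𝓝 (qform (fockKernel fock (r t)) N u)) := by
    intro r hr h0 N u
    have hpos : ∀ n, PosKernel fun j k => fockKernel fock (r t) j k - dyson γp γm X n t j k :=
      fun n => hr.posKernel_sub_dyson hγp hγm (by rw [h0]; exact hXX) n ht
    have h1 : Tendsto (fun n => ∑ l ∈ Finset.range n,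
        (fockKernel fock (r t) l l - dyson γp γm X n t l l).re) atTop (𝓝 0) := by
      rw [Metric.tendsto_atTop']
      intro ε hε
      obtain ⟨M, hM⟩ := eventually_atTop.mp
        (hr.eventually_trace_sub_dyson_le hγp hγm hXpos hXsum ht (half_pos hε))
      refine ⟨M, fun n hn => ?_⟩
      rw [Real.dist_eq, sub_zero, abs_of_nonneg
        (Finset.sum_nonneg fun l _ => (hpos n).diag_nonneg l)]
      have := hM n hn.le
      linarith
    have h2 : Tendsto (fun n => qform (fockKernel fock (r t)) N u - qform (dyson γp γm X n t) N u)
        atTop (𝓝 0) := by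
      have h3 := h1.const_mul (∑ k ∈ Finset.range N, ‖u k‖ ^ 2)
      rw [mul_zero] at h3
      refine squeeze_zero' (Eventually.of_forall fun n => ?_) ?_ h3
      · rw [← qform_sub]; exact hpos n N u
      · filter_upwards [eventually_ge_atTop N] with n hn
        rw [← qform_sub]
        refine ((hpos n).qform_le_trace N u).trans ?_
        refine mul_le_mul_of_nonneg_left ?_ (Finset.sum_nonneg fun _ _ => by positivity)
        exact Finset.sum_le_sum_of_subset_of_nonneg (Finset.range_subset_range.mpr hn)
          fun l _ _ => (hpos n).diag_nonneg l
    simpa using (tendsto_const_nhds (x := qform (fockKernel fock (r t)) N u)).sub h2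
  have hq : ∀ N u, qform (fockKernel fock (r t)) N u = qform (fockKernel fock (r' t)) N u :=
    fun N u => tendsto_nhds_unique (key r hr hX.symm N u) (key r' hr' (by rw [hX, h0]) N u)
  have hre : ∀ x, (⟪x, r t x⟫_ℂ).re = (⟪x, r' t x⟫_ℂ).re := by
    intro x
    have h1 := tendsto_qform_fockKernel (fock := fock) (r t) x
    have h2 := tendsto_qform_fockKernel (fock := fock) (r' t) x
    simp only [hq] at h1
    exact tendsto_nhds_unique h1 h2
  -- By polarization over `ℂ`, an operator with vanishing quadratic form is zero.
  have hinner : ∀ x, ⟪((r t - r' t : H →L[ℂ] H) : H →ₗ[ℂ] H) x, x⟫_ℂ = 0 := by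
    intro x
    rw [← inner_conj_symm]
    simp only [ContinuousLinearMap.coe_coe, sub_apply, inner_sub_right]
    have h1 := Complex.nonneg_iff.mp ((hr.1 t ht).1.inner_nonneg_right x)
    have h2 := Complex.nonneg_iff.mp ((hr'.1 t ht).1.inner_nonneg_right x)
    have h3 : ⟪x, r t x⟫_ℂ = ⟪x, r' t x⟫_ℂ := Complex.ext (hre x) (by rw [← h1.2, ← h2.2])
    rw [h3]; simp
  have := (inner_map_self_eq_zero _).mp hinner
  rw [← sub_eq_zero]
  ext x
  exact congrArg (fun S : H →ₗ[ℂ] H => S x) this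

end Transition
end

/-! ### Thermal states, their orbits and the function `g`. -/

noncomputable section

section Thermal

open ComplexConjugate
open scoped ComplexOrder

universe u

variable {H : Type u} [NormedAddCommGroup H] [InnerProductSpace ℂ H] [CompleteSpace H]
  {fock : HilbertBasis ℕ ℂ H} {γp γm : ℝ}

/-- The photon number distribution of the thermal state. -/
def thermalWeight (n : ℝ) (l : ℕ) : ℝ := n ^ l / (1 + n) ^ (l + 1)

theorem thermalWeight_nonneg {n : ℝ} (hn : 0 ≤ n) (l : ℕ) : 0 ≤ thermalWeight n l := by
  unfold thermalWeight; positivity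

theorem thermalWeight_eq {n : ℝ} (hn : 0 ≤ n) (l : ℕ) :
    thermalWeight n l = (n / (1 + n)) ^ l * (1 + n)⁻¹ := by
  have : (1 + n) ≠ 0 := by positivity
  rw [thermalWeight, div_pow, pow_succ]
  field_simp

theorem norm_div_one_add_lt_one {n : ℝ} (hn : 0 ≤ n) : ‖n / (1 + n)‖ < 1 := by
  rw [Real.norm_of_nonneg (by positivity), div_lt_one (by positivity)]
  linarith

theorem hasSum_thermalWeight {n : ℝ} (hn : 0 ≤ n) : HasSum (thermalWeight n) 1 := by
  have h := (hasSum_geometric_of_norm_lt_one (norm_div_one_add_lt_one hn)).mul_right (1 + n)⁻¹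
  have h1 : (1 + n) ≠ 0 := by positivity
  have h2 : (1 - n / (1 + n))⁻¹ * (1 + n)⁻¹ = 1 := by
    rw [one_sub_div h1]; field_simp; simp
  rw [h2] at h
  simpa only [← thermalWeight_eq hn] using h

theorem hasSum_mul_thermalWeight {n : ℝ} (hn : 0 ≤ n) :
    HasSum (fun l : ℕ => (l : ℝ) * thermalWeight n l) n := by
  have h := (hasSum_coe_mul_geometric_of_norm_lt_one (norm_div_one_add_lt_one hn)).mul_right
    (1 + n)⁻¹
  have h1 : (1 + n) ≠ 0 := by positivity
  have h2 : n / (1 + n) / (1 - n / (1 + n)) ^ 2 * (1 + n)⁻¹ = n := by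
    rw [one_sub_div h1, add_sub_cancel_right]; field_simp
  rw [h2] at h
  simpa only [mul_assoc, ← thermalWeight_eq hn] using h

theorem hasSum_thermal (fock : HilbertBasis ℕ ℂ H) {n : ℝ} (hn : 0 ≤ n) :
    HasSum (fun l : ℕ => (thermalWeight n l : ℂ) •
      (InnerProductSpace.rankOne ℂ (fock l) (fock l) : H →L[ℂ] H)) (thermal fock n) := by
  refine Summable.hasSum (Summable.of_norm ?_)
  refine (hasSum_thermalWeight hn).summable.congr fun l => ?_
  rw [norm_smul, InnerProductSpace.norm_rankOne, fock.orthonormal.1 l, Complex.norm_real,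
    Real.norm_of_nonneg (thermalWeight_nonneg hn l)]
  ring

theorem hasSum_thermal_apply (fock : HilbertBasis ℕ ℂ H) {n : ℝ} (hn : 0 ≤ n) (x : H) :
    HasSum (fun l : ℕ => (thermalWeight n l : ℂ) • ⟪fock l, x⟫_ℂ • fock l)
      (thermal fock n x) := by
  have h := (hasSum_thermal fock hn).mapL (ContinuousLinearMap.apply ℂ H x)
  simpa using h

theorem thermal_apply_fock (fock : HilbertBasis ℕ ℂ H) {n : ℝ} (hn : 0 ≤ n) (k : ℕ) :
    thermal fock n (fock k) = (thermalWeight n k : ℂ) • fock k := by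
  refine (hasSum_thermal_apply fock hn (fock k)).unique ?_
  convert hasSum_single k fun l hl => ?_ using 1
  · simp [fock.orthonormal.1 k]
  · simp [orthonormal_iff_ite.mp fock.orthonormal, hl]

theorem isPositive_thermal (fock : HilbertBasis ℕ ℂ H) {n : ℝ} (hn : 0 ≤ n) :
    (thermal fock n).IsPositive := by
  rw [ContinuousLinearMap.isPositive_iff_complex]
  intro x
  have h := (hasSum_thermal_apply fock hn x).mapL (innerSL ℂ x)
  have h1 : ∀ l, innerSL ℂ x ((thermalWeight n l : ℂ) • ⟪fock l, x⟫_ℂ • fock l)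
      = ((thermalWeight n l * ‖⟪fock l, x⟫_ℂ‖ ^ 2 : ℝ) : ℂ) := by
    intro l
    rw [map_smul, map_smul, innerSL_apply_apply, smul_eq_mul, smul_eq_mul,
      ← inner_conj_symm x (fock l), mul_comm (⟪fock l, x⟫_ℂ), ← Complex.normSq_eq_conj_mul_self,
      Complex.ofReal_mul, Complex.normSq_eq_norm_sq]
  simp only [h1] at h
  have h2 : Summable fun l => thermalWeight n l * ‖⟪fock l, x⟫_ℂ‖ ^ 2 := by
    exact_mod_cast h.summable
  have h3 : ⟪x, thermal fock n x⟫_ℂ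
      = ((∑' l, thermalWeight n l * ‖⟪fock l, x⟫_ℂ‖ ^ 2 : ℝ) : ℂ) :=
    h.unique (Complex.hasSum_ofReal.mpr h2.hasSum)
  rw [← inner_conj_symm, h3, Complex.conj_ofReal]
  exact ⟨by simp, by
    simpa using tsum_nonneg fun l => mul_nonneg (thermalWeight_nonneg hn l) (by positivity)⟩

theorem fockKernel_thermal (fock : HilbertBasis ℕ ℂ H) {n : ℝ} (hn : 0 ≤ n) (j k : ℕ) :
    fockKernel fock (thermal fock n) j k = if j = k then (thermalWeight n k : ℂ) else 0 := by
  rw [fockKernel, thermal_apply_fock fock hn, inner_smul_right,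
    orthonormal_iff_ite.mp fock.orthonormal]
  simp

theorem isDensity_thermal (fock : HilbertBasis ℕ ℂ H) {n : ℝ} (hn : 0 ≤ n) :
    IsDensity fock (thermal fock n) := by
  refine ⟨isPositive_thermal fock hn, ?_⟩
  have h := Complex.hasSum_ofReal.mpr (hasSum_thermalWeight hn)
  have h2 : ∀ l, ⟪fock l, thermal fock n (fock l)⟫_ℂ = (thermalWeight n l : ℂ) := fun l => by
    have := fockKernel_thermal fock hn l l
    rwa [if_pos rfl] at this
  simpa only [h2, Complex.ofReal_one] using h

theorem thermalWeight_le_one {n : ℝ} (hn : 0 ≤ n) (l : ℕ) : thermalWeight n l ≤ 1 :=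
  le_hasSum (hasSum_thermalWeight hn) l fun _ _ => thermalWeight_nonneg hn _

theorem hasSum_negMulLog_thermalWeight {n : ℝ} (hn : 0 ≤ n) :
    HasSum (fun l => Real.negMulLog (thermalWeight n l)) (thermalEntropy n) := by
  rcases hn.eq_or_lt with rfl | hn'
  · have h : ∀ l, Real.negMulLog (thermalWeight 0 l) = 0 := by
      intro l
      rcases l with _ | l <;> simp [thermalWeight]
    simp [h, thermalEntropy]
  · have h := ((hasSum_mul_thermalWeight hn).mul_right (Real.log (1 + n) - Real.log n)).add
      ((hasSum_thermalWeight hn).mul_right (Real.log (1 + n)))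
    have hf : ∀ l, Real.negMulLog (thermalWeight n l)
        = l * thermalWeight n l * (Real.log (1 + n) - Real.log n)
          + thermalWeight n l * Real.log (1 + n) := by
      intro l
      have hlog : Real.log (thermalWeight n l) = l * Real.log n - (l + 1) * Real.log (1 + n) := by
        rw [thermalWeight, Real.log_div (by positivity) (by positivity), Real.log_pow,
          Real.log_pow]
        push_cast
        ring
      simp only [Real.negMulLog, hlog]
      ring
    have hg : thermalEntropy n = n * (Real.log (1 + n) - Real.log n) + 1 * Real.log (1 + n) := by
      simp only [thermalEntropy, add_comm n 1]
      ring
    simpa only [hf, hg] using h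

theorem vnEntropy_thermal (fock : HilbertBasis ℕ ℂ H) {n : ℝ} (hn : 0 ≤ n) :
    vnEntropy fock (thermal fock n) = ENNReal.ofReal (thermalEntropy n) := by
  have hnn : ∀ l, 0 ≤ Real.negMulLog (thermalWeight n l) := fun l =>
    Real.negMulLog_nonneg (thermalWeight_nonneg hn l) (thermalWeight_le_one hn l)
  rw [vnEntropy_eq_tsum fock (isPositive_thermal fock hn).isSelfAdjoint fock
    (thermal_apply_fock fock hn) hnn, ← ENNReal.ofReal_tsum_of_nonneg hnn
    (hasSum_negMulLog_thermalWeight hn).summable, (hasSum_negMulLog_thermalWeight hn).tsum_eq]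

/-- The mean photon number along the orbit of a thermal state. -/
def meanPhotons (γp γm n t : ℝ) : ℝ :=
  n * Real.exp (-((γm - γp) * t)) + γp * ∫ s in (0 : ℝ)..t, Real.exp (-((γm - γp) * s))

theorem meanPhotons_zero (n : ℝ) : meanPhotons γp γm n 0 = n := by simp [meanPhotons]

theorem meanPhotons_nonneg (hγp : 0 ≤ γp) {n : ℝ} (hn : 0 ≤ n) {t : ℝ} (ht : 0 ≤ t) :
    0 ≤ meanPhotons γp γm n t := by
  have : 0 ≤ ∫ s in (0 : ℝ)..t, Real.exp (-((γm - γp) * s)) :=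
    intervalIntegral.integral_nonneg ht fun _ _ => Real.exp_nonneg _
  unfold meanPhotons
  positivity

theorem hasDerivAt_exp_neg_mul (c t : ℝ) :
    HasDerivAt (fun t => Real.exp (-(c * t))) (-c * Real.exp (-(c * t))) t := by
  have := ((hasDerivAt_id t).const_mul c).neg.exp
  simpa [mul_comm] using this

/-- Keeping the solution in integral form covers `γ₊ = γ₋`, where the closed formula would divide by
zero. -/
theorem hasDerivAt_meanPhotons (n t : ℝ) :
    HasDerivAt (meanPhotons γp γm n)
      (γp * (meanPhotons γp γm n t + 1) - γm * meanPhotons γp γm n t) t := by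
  set c := γm - γp with hc
  have hcont : Continuous fun s => Real.exp (-(c * s)) := by fun_prop
  have h1 := intervalIntegral.integral_hasDerivAt_right (hcont.intervalIntegrable 0 t)
    (hcont.stronglyMeasurableAtFilter _ _) hcont.continuousAt
  have hI : -c * ∫ s in (0 : ℝ)..t, Real.exp (-(c * s)) = Real.exp (-(c * t)) - 1 := by
    rw [← intervalIntegral.integral_const_mul,
      intervalIntegral.integral_eq_sub_of_hasDerivAt (fun s _ => hasDerivAt_exp_neg_mul c s)
        (Continuous.intervalIntegrable (by fun_prop) _ _)]
    simp
  refine (((hasDerivAt_exp_neg_mul c t).const_mul n).add (h1.const_mul γp)).congr_deriv ?_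
  rw [meanPhotons, ← hc]
  linear_combination (-γp) * hI - (n * Real.exp (-(c * t))
    + γp * ∫ s in (0 : ℝ)..t, Real.exp (-(c * s))) * hc

theorem hasDerivAt_thermalWeight {n : ℝ} (hn : 0 ≤ n) (l : ℕ) :
    HasDerivAt (fun n => thermalWeight n l)
      ((l * n ^ (l - 1) * (1 + n) - (l + 1) * n ^ l) / (1 + n) ^ (l + 2)) n := by
  have h1 : (1 + n) ≠ 0 := by positivity
  have h := (hasDerivAt_pow l n).div (((hasDerivAt_id n).const_add 1).pow (l + 1))
    (pow_ne_zero _ h1)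
  refine h.congr_deriv ?_
  simp only [id, Nat.add_sub_cancel, mul_one, Pi.pow_apply]
  rw [div_eq_div_iff (by positivity) (by positivity)]
  push_cast
  ring

/-- Invariance of the thermal family: moving the parameter `n` at rate `γ₊(n + 1) - γ₋ n` reproduces
the rate equation for the populations. -/
theorem thermalWeight_rate {n : ℝ} (hn : 0 ≤ n) (l : ℕ) :
    (l * n ^ (l - 1) * (1 + n) - (l + 1) * n ^ l) / (1 + n) ^ (l + 2)
        * (γp * (n + 1) - γm * n)
      = γp * l * thermalWeight n (l - 1) + γm * (l + 1) * thermalWeight n (l + 1)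
        - lossRate γp γm l * thermalWeight n l := by
  have h1 : (1 + n) ≠ 0 := by positivity
  rcases l with _ | l
  · simp only [thermalWeight, lossRate]
    field_simp
    push_cast
    ring
  · simp only [thermalWeight, lossRate, Nat.add_sub_cancel]
    field_simp
    push_cast
    ring

theorem isOrbit_thermal (fock : HilbertBasis ℕ ℂ H) (hγp : 0 ≤ γp) {n : ℝ} (hn : 0 ≤ n) :
    IsOrbit fock γp γm fun t => thermal fock (meanPhotons γp γm n t) := by
  have hnn : ∀ t : ℝ, 0 ≤ t → 0 ≤ meanPhotons γp γm n t := fun t ht =>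
    meanPhotons_nonneg hγp hn ht
  refine ⟨fun t ht => isDensity_thermal fock (hnn t ht), fun j k t ht => ?_⟩
  rw [lindblad_single]
  have hd : HasDerivWithinAt (fun s => if j = k then (thermalWeight (meanPhotons γp γm n s) k : ℂ)
      else 0) (gain γp γm (fockKernel fock (thermal fock (meanPhotons γp γm n t))) j k
        - (decayRate γp γm j k : ℂ) * fockKernel fock (thermal fock (meanPhotons γp γm n t)) j k)
      (Set.Ici 0) t := by
    simp only [gain, fockKernel_thermal fock (hnn t ht)]
    by_cases hjk : j = k
    · subst hjk
      have h := (((hasDerivAt_thermalWeight (hnn t ht) j).comp t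
        (hasDerivAt_meanPhotons (γp := γp) (γm := γm) n t)).ofReal_comp).hasDerivWithinAt
          (s := Set.Ici 0)
      rw [thermalWeight_rate (hnn t ht)] at h
      simp only [if_true]
      refine h.congr_deriv ?_
      have h1 : Real.sqrt j * Real.sqrt j = j := Real.mul_self_sqrt (by positivity)
      have h2 : Real.sqrt (j + 1) * Real.sqrt (j + 1) = (j : ℝ) + 1 :=
        Real.mul_self_sqrt (by positivity)
      have h3 : decayRate γp γm j j = lossRate γp γm j := by simp [decayRate]
      rw [h1, h2, h3]
      push_cast
      ring
    · have h2 : ¬ (j + 1 = k + 1) := by omega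
      have h4 : ((γp * (Real.sqrt j * Real.sqrt k) : ℝ) : ℂ) *
          (if j - 1 = k - 1 then (thermalWeight (meanPhotons γp γm n t) (k - 1) : ℂ) else 0)
            = 0 := by
        split_ifs with h
        · have : j = 0 ∨ k = 0 := by omega
          rcases this with rfl | rfl <;> simp
        · simp
      simp only [hjk, h2, if_false, mul_zero, add_zero, sub_zero, h4]
      exact hasDerivWithinAt_const _ _ _
  refine hd.congr_of_mem (fun s hs => ?_) ht
  rw [matrixElement_single, fockKernel_thermal fock (hnn s hs)]
  simp

theorem hasDerivAt_thermalEntropy {n : ℝ} (hn : 0 < n) :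
    HasDerivAt thermalEntropy (Real.log (n + 1) - Real.log n) n := by
  have h1 : HasDerivAt (fun n : ℝ => (n + 1) * Real.log (n + 1)) (Real.log (n + 1) + 1) n := by
    have := (Real.hasDerivAt_mul_log (x := n + 1) (by positivity)).comp n
      ((hasDerivAt_id n).add_const 1)
    simpa [Function.comp_def] using this
  refine (h1.sub (Real.hasDerivAt_mul_log hn.ne')).congr_deriv ?_
  ring

theorem continuous_thermalEntropy : Continuous thermalEntropy :=
  (Real.continuous_mul_log.comp (continuous_id.add continuous_const)).sub Real.continuous_mul_log

theorem one_div_le_log_sub_log {n : ℝ} (hn : 0 < n) :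
    1 / (n + 1) ≤ Real.log (n + 1) - Real.log n := by
  have h := Real.log_le_sub_one_of_pos (div_pos hn (show (0 : ℝ) < n + 1 by positivity))
  rw [Real.log_div hn.ne' (by positivity)] at h
  have : n / (n + 1) = 1 - 1 / (n + 1) := by field_simp; ring
  linarith

/-- On `(0, B)` one has `g'(x) = ln(x + 1) - ln x ≥ 1/(x + 1) ≥ 1/(B + 1)`. So the inverse of `g` is
Lipschitz on bounded ranges, which transfers the entropy bound to photon numbers. -/
theorem sub_div_le_thermalEntropy_sub {a b B : ℝ} (ha : 0 ≤ a) (hab : a ≤ b) (hb : b ≤ B) :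
    (b - a) / (B + 1) ≤ thermalEntropy b - thermalEntropy a := by
  have hB : 0 < B + 1 := by linarith
  have hd : ∀ x ∈ interior (Set.Icc 0 B), HasDerivAt (fun x => thermalEntropy x - x / (B + 1))
      (Real.log (x + 1) - Real.log x - 1 / (B + 1)) x := by
    intro x hx
    rw [interior_Icc] at hx
    exact (hasDerivAt_thermalEntropy hx.1).sub ((hasDerivAt_id x).div_const (B + 1))
  have hmono : MonotoneOn (fun x => thermalEntropy x - x / (B + 1)) (Set.Icc 0 B) := by
    refine monotoneOn_of_deriv_nonneg (convex_Icc 0 B)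
      (continuous_thermalEntropy.sub (continuous_id.div_const _)).continuousOn
      (fun x hx => (hd x hx).differentiableAt.differentiableWithinAt) fun x hx => ?_
    rw [(hd x hx).deriv]
    rw [interior_Icc] at hx
    have h1 := one_div_le_log_sub_log hx.1
    have h2 : 1 / (B + 1) ≤ 1 / (x + 1) :=
      one_div_le_one_div_of_le (by linarith [hx.1]) (by linarith [hx.2])
    linarith
  have h := hmono ⟨ha, hab.trans hb⟩ ⟨ha.trans hab, hb⟩ hab
  simp only at h
  rw [sub_div]
  linarith

theorem thermalEntropy_le_iff {a b : ℝ} (ha : 0 ≤ a) (hb : 0 ≤ b) :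
    thermalEntropy a ≤ thermalEntropy b ↔ a ≤ b := by
  constructor
  · intro h
    by_contra hab
    have h1 := sub_div_le_thermalEntropy_sub hb (not_le.mp hab).le le_rfl
    have h2 : 0 < (a - b) / (a + 1) := div_pos (by linarith) (by linarith)
    linarith
  · intro hab
    have h1 := sub_div_le_thermalEntropy_sub ha hab le_rfl
    have h2 : 0 ≤ (b - a) / (b + 1) := div_nonneg (by linarith) (by linarith)
    linarith

theorem thermalEntropy_zero : thermalEntropy 0 = 0 := by simp [thermalEntropy]

theorem thermalEntropy_nonneg {n : ℝ} (hn : 0 ≤ n) : 0 ≤ thermalEntropy n := by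
  rw [← thermalEntropy_zero]
  exact (thermalEntropy_le_iff le_rfl hn).mpr hn

theorem exists_thermalEntropy_eq {s : ℝ} (hs : 0 ≤ s) : ∃ n, 0 ≤ n ∧ thermalEntropy n = s := by
  -- The endpoint `e^s - 1` works because `g(e^s - 1) = s + (e^s - 1)(s - ln(e^s - 1)) ≥ s`.
  have h0 : 0 ≤ Real.exp s - 1 := by linarith [Real.add_one_le_exp s]
  have h1 : s ≤ thermalEntropy (Real.exp s - 1) := by
    have : 0 ≤ (Real.exp s - 1) * (Real.log (Real.exp s) - Real.log (Real.exp s - 1)) := by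
      rcases h0.eq_or_lt with h | h
      · rw [← h]; simp
      · exact mul_nonneg h0 (sub_nonneg.mpr (Real.log_le_log h (by linarith)))
    rw [thermalEntropy, sub_add_cancel, Real.log_exp] at *
    linarith
  obtain ⟨n, hn, hns⟩ := intermediate_value_Icc h0 continuous_thermalEntropy.continuousOn
    (show s ∈ Set.Icc (thermalEntropy 0) (thermalEntropy (Real.exp s - 1)) from
      ⟨by rw [thermalEntropy_zero]; exact hs, h1⟩)
  exact ⟨n, hn.1, hns⟩

end Thermal
end

/-! ### No pure states at positive times when `γ₊ > 0`. -/

noncomputable section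

section Purity

open ComplexConjugate
open scoped ComplexOrder

universe u

variable {H : Type u} [NormedAddCommGroup H] [InnerProductSpace ℂ H] [CompleteSpace H]
  {fock : HilbertBasis ℕ ℂ H} {γp γm : ℝ}

theorem ContinuousLinearMap.IsPositive.norm_inner_sq_le {ρ : H →L[ℂ] H} (hρ : ρ.IsPositive)
    (x y : H) : ‖⟪x, ρ y⟫_ℂ‖ ^ 2 ≤ (⟪x, ρ x⟫_ℂ).re * (⟪y, ρ y⟫_ℂ).re := by
  have hpos : 0 ≤ ρ := (ContinuousLinearMap.nonneg_iff_isPositive ρ).mpr hρ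
  set A := CFC.sqrt ρ with hAdef
  have hA : IsSelfAdjoint A := (CFC.sqrt_nonneg ρ).isSelfAdjoint
  have hAA : A * A = ρ := CFC.sqrt_mul_sqrt_self ρ
  have h : ∀ x y, ⟪x, ρ y⟫_ℂ = ⟪A x, A y⟫_ℂ := by
    intro x y
    have h1 : ⟪A x, A y⟫_ℂ = ⟪x, A (A y)⟫_ℂ := hA.isSymmetric _ _
    rw [← hAA, mul_apply_eq_comp, ← h1]
  have h2 : ∀ x, (⟪x, ρ x⟫_ℂ).re = ‖A x‖ ^ 2 := fun x => by
    rw [h]; exact inner_self_eq_norm_sq (𝕜 := ℂ) _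
  rw [h, h2, h2, ← mul_pow]
  gcongr
  exact norm_inner_le_norm _ _

/-- Zero entropy forces every eigenvalue to be 0 or 1, and the unit trace leaves exactly one
eigenvalue 1. -/
theorem IsDensity.exists_eq_pureKernel {ρ : H →L[ℂ] H} (h : IsDensity fock ρ)
    (h0 : vnEntropy fock ρ = 0) :
    ∃ x : H, x ≠ 0 ∧ fockKernel fock ρ = pureKernel fock x := by
  obtain ⟨ι, e, p, he, hp0, hnp, hp, hS⟩ := h.exists_spectral
  rw [hS, ENNReal.tsum_eq_zero] at h0
  have h01 : ∀ i, p i = 0 ∨ p i = 1 := by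
    intro i
    have h1 := le_antisymm (ENNReal.ofReal_eq_zero.mp (h0 i)) (hnp i)
    simp only [Real.negMulLog, neg_mul, neg_eq_zero, mul_eq_zero, Real.log_eq_zero] at h1
    have := hp0 i
    rcases h1 with h | h | h | h
    · exact Or.inl h
    · exact Or.inl h
    · exact Or.inr h
    · linarith
  obtain ⟨i₀, hi₀⟩ : ∃ i, p i = 1 := by
    by_contra hcon
    push Not at hcon
    have : p = fun _ => 0 := funext fun i => (h01 i).resolve_right (hcon i)
    rw [this] at hp
    exact zero_ne_one (hasSum_zero.unique hp)
  have hother : ∀ i, i ≠ i₀ → p i = 0 := by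
    classical
    intro i hi
    have h1 := sum_le_hasSum {i, i₀} (fun j _ => hp0 j) hp
    rw [Finset.sum_pair hi, hi₀] at h1
    linarith [hp0 i]
  refine ⟨e i₀, fun h => by simpa [h] using e.orthonormal.1 i₀, ?_⟩
  have hsa : IsSelfAdjoint ρ := h.1.isSelfAdjoint
  ext j k
  have h1 := e.hasSum_inner_mul_inner (fock j) (ρ (fock k))
  have h2 : ∀ i, ⟪e i, ρ (fock k)⟫_ℂ = p i * ⟪e i, fock k⟫_ℂ := by
    intro i
    have h3 : ⟪ρ (e i), fock k⟫_ℂ = ⟪e i, ρ (fock k)⟫_ℂ := hsa.isSymmetric _ _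
    rw [← h3, he, inner_smul_left, Complex.conj_ofReal]
  simp only [h2] at h1
  refine h1.unique ?_
  convert hasSum_single i₀ fun i hi => ?_ using 1
  · rw [pureKernel, hi₀, inner_conj_symm]; simp
  · simp [hother i hi]

/-- Let `l` be the lowest Fock level present in the pure state. The 2×2 minor of the state on levels
`l, l + 1` is nonnegative along the orbit and zero at `t > 0`, so its derivative vanishes there. Yet
emission from `l` into `l + 1` makes that derivative positive. -/
theorem IsOrbit.vnEntropy_ne_zero (hγp : 0 < γp) (hγm : 0 ≤ γm) {r : ℝ → H →L[ℂ] H}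
    (hr : IsOrbit fock γp γm r) {t : ℝ} (ht : 0 < t) : vnEntropy fock (r t) ≠ 0 := by
  intro h0
  obtain ⟨x, hx0, hx⟩ := (hr.1 t ht.le).exists_eq_pureKernel h0
  set a : ℕ → ℂ := fun l => ⟪fock l, x⟫_ℂ with ha
  have hX : ∀ j k, fockKernel fock (r t) j k = a j * conj (a k) := fun j k => by rw [hx]; rfl
  have hex : ∃ l, a l ≠ 0 := by
    by_contra hcon
    push Not at hcon
    have h1 := fock.hasSum_norm_inner_sq x
    have h2 : ∀ i, ‖⟪fock i, x⟫_ℂ‖ ^ 2 = 0 := fun i => by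
      rw [show ⟪fock i, x⟫_ℂ = 0 from hcon i]; simp
    simp only [h2] at h1
    exact hx0 (by simpa using h1.unique hasSum_zero)
  classical
  set l := Nat.find hex with hl
  have hal : a l ≠ 0 := Nat.find_spec hex
  -- Nothing is pumped up from below level `l`: either `l = 0` or the amplitude at `l - 1` vanishes.
  have hmin : ∀ k, (Real.sqrt l : ℂ) * a (l - 1) * k = 0 := by
    intro k
    rcases Nat.eq_zero_or_pos l with h | h
    · simp [h]
    · have : a (l - 1) = 0 := by
        by_contra hcon
        exact Nat.find_min hex (show l - 1 < Nat.find hex by omega) hcon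
      simp [this]
  set b : ℕ → ℂ := fun j => (Real.sqrt (j + 1) : ℂ) * a (j + 1) with hb
  have hder : ∀ j k, HasDerivAt (fun s => fockKernel fock (r s) j k)
      (gain γp γm (fockKernel fock (r t)) j k
        - (decayRate γp γm j k : ℂ) * fockKernel fock (r t) j k) t := fun j k =>
    (hr.hasDerivWithinAt j k ht.le).hasDerivAt (Ici_mem_nhds ht)
  have hll : gain γp γm (fockKernel fock (r t)) l l = γm * (b l * conj (b l)) := by
    simp only [gain, hX, hb, map_mul, Complex.conj_ofReal]
    push_cast
    linear_combination (γp * Real.sqrt l : ℂ) * hmin (conj (a (l - 1)))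
  have hlm : gain γp γm (fockKernel fock (r t)) l (l + 1) = γm * (b l * conj (b (l + 1))) := by
    simp only [gain, hX, hb, map_mul, Complex.conj_ofReal, Nat.add_sub_cancel]
    push_cast
    linear_combination (γp * Real.sqrt (l + 1) : ℂ) * hmin (conj (a l))
  have hmm : gain γp γm (fockKernel fock (r t)) (l + 1) (l + 1)
      = γp * (l + 1) * (a l * conj (a l)) + γm * (b (l + 1) * conj (b (l + 1))) := by
    have h2 : (Real.sqrt (l + 1) : ℂ) * (Real.sqrt (l + 1) : ℂ) = (l : ℂ) + 1 := by
      rw [← Complex.ofReal_mul, Real.mul_self_sqrt (by positivity)]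
      push_cast; rfl
    simp only [gain, hX, hb, map_mul, Complex.conj_ofReal, Nat.add_sub_cancel]
    push_cast
    linear_combination (γp * (a l * conj (a l)) : ℂ) * h2
  set μ : ℝ → ℝ := fun s => (fockKernel fock (r s) l l).re
    * (fockKernel fock (r s) (l + 1) (l + 1)).re
    - ((fockKernel fock (r s) l (l + 1)).re * (fockKernel fock (r s) l (l + 1)).re
      + (fockKernel fock (r s) l (l + 1)).im * (fockKernel fock (r s) l (l + 1)).im) with hμ
  have hre : ∀ j k, HasDerivAt (fun s => (fockKernel fock (r s) j k).re)
      (gain γp γm (fockKernel fock (r t)) j k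
        - (decayRate γp γm j k : ℂ) * fockKernel fock (r t) j k).re t := fun j k =>
    Complex.reCLM.hasFDerivAt.comp_hasDerivAt t (hder j k)
  have him : ∀ j k, HasDerivAt (fun s => (fockKernel fock (r s) j k).im)
      (gain γp γm (fockKernel fock (r t)) j k
        - (decayRate γp γm j k : ℂ) * fockKernel fock (r t) j k).im t := fun j k =>
    Complex.imCLM.hasFDerivAt.comp_hasDerivAt t (hder j k)
  have hdμ := ((hre l l).mul (hre (l + 1) (l + 1))).sub
    (((hre l (l + 1)).mul (hre l (l + 1))).add ((him l (l + 1)).mul (him l (l + 1))))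
  have hμ0 : μ t = 0 := by
    simp only [hμ, hX, Complex.mul_re, Complex.mul_im, Complex.conj_re, Complex.conj_im]
    ring
  have hlocal : IsLocalMin μ t := by
    filter_upwards [Ici_mem_nhds ht] with s hs
    rw [hμ0]
    have h := (hr.1 s hs).1.norm_inner_sq_le (fock l) (fock (l + 1))
    rw [← Complex.normSq_eq_norm_sq, Complex.normSq_apply] at h
    exact sub_nonneg.mpr h
  have hzero := hlocal.hasDerivAt_eq_zero hdμ
  rw [hll, hlm, hmm] at hzero
  simp only [hX, decayRate] at hzero
  have hpos : 0 < Complex.normSq (a l) := Complex.normSq_pos.mpr hal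
  -- The derivative of the minor. The decay terms drop out because they only multiply the minor,
  -- which is zero: the two diagonal rates sum to twice the off-diagonal one.
  have hid : γm * Complex.normSq (a (l + 1) * b l - a l * b (l + 1))
      + γp * (l + 1) * Complex.normSq (a l) ^ 2 = 0 := by
    rw [← hzero]
    simp only [Complex.normSq_apply, Complex.mul_re, Complex.mul_im, Complex.conj_re,
      Complex.conj_im, Complex.sub_re, Complex.sub_im, Complex.add_re, Complex.add_im,
      Complex.ofReal_re, Complex.ofReal_im, Complex.natCast_re, Complex.natCast_im, Complex.one_re,
      Complex.one_im]
    ring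
  have h1 : 0 ≤ γm * Complex.normSq (a (l + 1) * b l - a l * b (l + 1)) :=
    mul_nonneg hγm (Complex.normSq_nonneg _)
  have h2 : 0 < γp * (l + 1) * Complex.normSq (a l) ^ 2 := by positivity
  linarith

end Purity

/-! ### A comparison principle for functions that are monotone up to a linear term. -/

section Comparison

/-- The monotone function `φ = f + K t` is differentiable almost everywhere and its increment is at
least `∫ φ'`, since jumps and singular parts only go up. As `φ' ≥ K` almost everywhere, `φ` gains at
least `K T`. -/
theorem le_of_monotoneOn_add_mul {f : ℝ → ℝ} {K T : ℝ} (hT : 0 ≤ T)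
    (hmono : MonotoneOn (fun t => f t + K * t) (Set.Icc 0 T))
    (hderiv : ∀ t ∈ Set.Ioo 0 T, ∀ d, HasDerivAt f d t → 0 ≤ d) : f 0 ≤ f T := by
  set φ : ℝ → ℝ := fun t => f t + K * t with hφ
  have hmono' : MonotoneOn φ (Set.uIcc 0 T) := by rwa [Set.uIcc_of_le hT]
  have h1 := hmono'.intervalIntegral_deriv_mem_uIcc
  have h2 : 0 ≤ φ T - φ 0 := sub_nonneg.mpr
    (hmono (Set.left_mem_Icc.mpr hT) (Set.right_mem_Icc.mpr hT) hT)
  rw [Set.uIcc_of_le h2] at h1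
  have h3 : ∫ _ in (0 : ℝ)..T, K ≤ ∫ t in (0 : ℝ)..T, deriv φ t := by
    refine intervalIntegral.integral_mono_ae_restrict hT (by simp) hmono'.intervalIntegrable_deriv ?_
    have h4 := hmono.ae_differentiableWithinAt measurableSet_Icc
    rw [← MeasureTheory.restrict_Ioo_eq_restrict_Icc] at h4 ⊢
    filter_upwards [h4, MeasureTheory.ae_restrict_mem measurableSet_Ioo] with t ht htT
    have hd : DifferentiableAt ℝ φ t := ht.differentiableAt (Icc_mem_nhds htT.1 htT.2)
    have hf : HasDerivAt f (deriv φ t - K) t := by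
      have := hd.hasDerivAt.sub ((hasDerivAt_id t).const_mul K)
      simpa [hφ, Function.comp_def, Pi.sub_def] using this
    have := hderiv t htT _ hf
    linarith
  rw [intervalIntegral.integral_const, smul_eq_mul, sub_zero] at h3
  have := h1.2
  simp only [hφ, mul_zero] at this
  linarith

theorem exists_lipschitz_of_hasDerivAt {g g' : ℝ → ℝ} (hg : ∀ t, HasDerivAt g (g' t) t)
    (hg' : Continuous g') (T : ℝ) :
    ∃ L, 0 ≤ L ∧ ∀ s ∈ Set.Icc 0 T, ∀ t ∈ Set.Icc 0 T, |g t - g s| ≤ L * |t - s| := by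
  obtain ⟨C, hC⟩ := (isCompact_Icc (a := (0 : ℝ)) (b := T)).exists_bound_of_continuousOn
    hg'.continuousOn
  refine ⟨max C 0, le_max_right _ _, fun s hs t ht => ?_⟩
  exact (convex_Icc 0 T).norm_image_sub_le_of_norm_hasDerivWithin_le
    (fun x _ => (hg x).hasDerivWithinAt) (fun x hx => (hC x hx).trans (le_max_left _ _)) hs ht

end Comparison

/-! ### The differential inequality for the photon number and the conclusion. -/

section Main

universe u

variable {H : Type u} [NormedAddCommGroup H] [InnerProductSpace ℂ H] [CompleteSpace H]
  {fock : HilbertBasis ℕ ℂ H} {γp γm : ℝ}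

theorem hasEntropyRate_of_hasDerivAt {r : ℝ → H →L[ℂ] H} {s : ℝ → ℝ} {d : ℝ}
    (hs : HasDerivAt s d 0) (hs0 : 0 ≤ s 0) (h0 : vnEntropy fock (r 0) = ENNReal.ofReal (s 0))
    (h : ∀ᶠ t in 𝓝[>] (0 : ℝ), 0 ≤ s t ∧ vnEntropy fock (r t) = ENNReal.ofReal (s t)) :
    HasEntropyRate fock r (d : EReal) := by
  have h1 := (hasDerivWithinAt_iff_tendsto_slope' (by simp)).mp
    (hs.hasDerivWithinAt (s := Set.Ioi 0))
  have h2 := (continuous_coe_real_ereal.tendsto d).comp h1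
  refine h2.congr' ?_
  filter_upwards [h] with t ht
  rw [ht.2, h0, EReal.coe_ennreal_ofReal, EReal.coe_ennreal_ofReal, max_eq_left ht.1,
    max_eq_left hs0, ← EReal.coe_sub, ← EReal.coe_div]
  simp [slope_def_field]

/-- The orbit restarted at `t` is compared with the thermal orbit from `N t`. By the chain rule both
entropy rates carry the factor `g'(N t) > 0`, which cancels. -/
theorem meanPhotons_rate_le_of_infinitesimal (hγp : 0 ≤ γp)
    (hinf : InfinitesimalMinOutputEntropy fock γp γm) {r : ℝ → H →L[ℂ] H}
    (hr : IsOrbit fock γp γm r) {N : ℝ → ℝ} {t d : ℝ} (ht : 0 ≤ t)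
    (hN : ∀ᶠ s in 𝓝 t, 0 ≤ N s ∧ vnEntropy fock (r s) = ENNReal.ofReal (thermalEntropy (N s)))
    (hpos : 0 < N t) (hd : HasDerivAt N d t) :
    γp * (N t + 1) - γm * N t ≤ d := by
  set G := Real.log (N t + 1) - Real.log (N t) with hG
  have hGpos : 0 < G := lt_of_lt_of_le (by positivity) (one_div_le_log_sub_log hpos)
  have hrate : HasEntropyRate fock (fun s => r (t + s)) ((G * d : ℝ) : EReal) := by
    have h1 : HasDerivAt (fun s => thermalEntropy (N (t + s))) (G * d) 0 := by
      have h2 : HasDerivAt (fun s => N (t + s)) d 0 := by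
        have := HasDerivAt.comp_const_add t 0 (by simpa using hd)
        exact this
      have h3 : HasDerivAt thermalEntropy G (N (t + 0)) := by
        rw [add_zero]; exact hasDerivAt_thermalEntropy hpos
      exact h3.comp 0 h2
    refine hasEntropyRate_of_hasDerivAt h1 (thermalEntropy_nonneg (by simpa using hpos.le))
      (by simpa using hN.self_of_nhds.2) ?_
    have htend : Tendsto (fun s : ℝ => t + s) (𝓝[>] 0) (𝓝 t) := by
      have : Tendsto (fun s : ℝ => t + s) (𝓝 0) (𝓝 (t + 0)) :=
        (continuous_const.add continuous_id).tendsto 0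
      rw [add_zero] at this
      exact this.mono_left nhdsWithin_le_nhds
    filter_upwards [htend.eventually hN] with s hs
    exact ⟨thermalEntropy_nonneg hs.1, hs.2⟩
  have hrth : HasEntropyRate fock (fun s => thermal fock (meanPhotons γp γm (N t) s))
      ((G * (γp * (N t + 1) - γm * N t) : ℝ) : EReal) := by
    have h1 : HasDerivAt (fun s => thermalEntropy (meanPhotons γp γm (N t) s))
        (G * (γp * (N t + 1) - γm * N t)) 0 := by
      have h2 := hasDerivAt_meanPhotons (γp := γp) (γm := γm) (N t) 0
      have h3 : HasDerivAt thermalEntropy G (meanPhotons γp γm (N t) 0) := by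
        rw [meanPhotons_zero]; exact hasDerivAt_thermalEntropy hpos
      rw [meanPhotons_zero] at h2
      exact h3.comp 0 h2
    have hnn : ∀ s : ℝ, 0 ≤ s → 0 ≤ meanPhotons γp γm (N t) s := fun s hs =>
      meanPhotons_nonneg hγp hpos.le hs
    refine hasEntropyRate_of_hasDerivAt h1 (thermalEntropy_nonneg (hnn 0 le_rfl))
      (vnEntropy_thermal fock (hnn 0 le_rfl)) ?_
    filter_upwards [self_mem_nhdsWithin] with s hs
    exact ⟨thermalEntropy_nonneg (hnn s (le_of_lt hs)), vnEntropy_thermal fock (hnn s (le_of_lt hs))⟩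
  have hSpos : 0 < thermalEntropy (N t) := by
    rcases (thermalEntropy_nonneg hpos.le).eq_or_lt with h | h
    · rw [← thermalEntropy_zero] at h
      exact absurd ((thermalEntropy_le_iff hpos.le le_rfl).mp h.ge) (not_le.mpr hpos)
    · exact h
  have h := hinf (thermalEntropy (N t)) hSpos (N t) hpos.le rfl _ _ (hr.shift ht)
    (by simpa using hN.self_of_nhds.2) (isOrbit_thermal fock hγp hpos.le)
    (by simp only [meanPhotons_zero]) _ _ hrate hrth
  rw [EReal.coe_le_coe_iff] at h
  exact le_of_mul_le_mul_left h hGpos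

end Main
end

theorem mainTheorem2 {H : Type*} [NormedAddCommGroup H] [InnerProductSpace ℂ H] [CompleteSpace H]
    (fock : HilbertBasis ℕ ℂ H) (γp γm : ℝ) (hγp : 0 ≤ γp) (hγm : 0 ≤ γm) :
    InfinitesimalMinOutputEntropy fock γp γm → MinOutputEntropy fock γp γm := by
  intro hinf S₀ hS₀ nbar hnbar hg r rth hr hrS hrth hrth0 T hT
  have hth : rth T = thermal fock (meanPhotons γp γm nbar T) :=
    hrth.eq_of_zero_eq hγp hγm (isOrbit_thermal fock hγp hnbar)
      (by rw [hrth0, meanPhotons_zero]) hT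
  rw [hth, vnEntropy_thermal fock (meanPhotons_nonneg hγp hnbar hT)]
  -- Infinite final entropy is trivial; otherwise the one-sided bound makes the entropy finite on
  -- all of `[0, T]`.
  by_cases htop : vnEntropy fock (r T) = ⊤
  · rw [htop]; exact le_top
  set k := |γm - γp| with hk
  have hk0 : 0 ≤ k := abs_nonneg _
  have hfin : ∀ s ∈ Set.Icc 0 T, vnEntropy fock (r s) ≠ ⊤ := fun s hs =>
    ne_top_of_le_ne_top (ENNReal.add_ne_top.mpr ⟨htop, ENNReal.ofReal_ne_top⟩)
      (hr.vnEntropy_le hγp hγm hs.1 hs.2)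
  choose N hN0 hNS using fun s : ℝ =>
    exists_thermalEntropy_eq (ENNReal.toReal_nonneg (a := vnEntropy fock (r s)))
  have hS : ∀ s ∈ Set.Icc 0 T, vnEntropy fock (r s) = ENNReal.ofReal (thermalEntropy (N s)) :=
    fun s hs => by rw [hNS, ENNReal.ofReal_toReal (hfin s hs)]
  have hstep : ∀ s ∈ Set.Icc 0 T, ∀ t ∈ Set.Icc 0 T, s ≤ t →
      thermalEntropy (N s) ≤ thermalEntropy (N t) + k * (t - s) := by
    intro s hs t ht hst
    have h := hr.vnEntropy_le hγp hγm hs.1 hst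
    have hkt : 0 ≤ k * (t - s) := mul_nonneg hk0 (sub_nonneg.mpr hst)
    rw [hS s hs, hS t ht, ← ENNReal.ofReal_add (thermalEntropy_nonneg (hN0 t)) hkt] at h
    exact (ENNReal.ofReal_le_ofReal_iff (add_nonneg (thermalEntropy_nonneg (hN0 t)) hkt)).mp h
  have hTmem : T ∈ Set.Icc 0 T := Set.right_mem_Icc.mpr hT
  have h0mem : (0 : ℝ) ∈ Set.Icc 0 T := Set.left_mem_Icc.mpr hT
  -- The one-sided bound keeps the entropy on `[0, T]` below its value at `T` plus `k T`; `B` is the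
  -- corresponding photon number.
  obtain ⟨B, hB0, hBS⟩ := exists_thermalEntropy_eq
    (add_nonneg (thermalEntropy_nonneg (hN0 T)) (mul_nonneg hk0 hT))
  have hNB : ∀ s ∈ Set.Icc 0 T, N s ≤ B := by
    intro s hs
    rw [← thermalEntropy_le_iff (hN0 s) hB0, hBS]
    refine (hstep s hs T hTmem hs.2).trans ?_
    have : k * (T - s) ≤ k * T := mul_le_mul_of_nonneg_left (by linarith [hs.1]) hk0
    linarith
  have hNstep : ∀ s ∈ Set.Icc 0 T, ∀ t ∈ Set.Icc 0 T, s ≤ t →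
      N s - N t ≤ k * (B + 1) * (t - s) := by
    intro s hs t ht hst
    rcases le_total (N s) (N t) with h | h
    · have : 0 ≤ k * (B + 1) * (t - s) :=
        mul_nonneg (mul_nonneg hk0 (by linarith)) (sub_nonneg.mpr hst)
      linarith
    · have h1 := sub_div_le_thermalEntropy_sub (hN0 t) h (hNB s hs)
      have h2 := hstep s hs t ht hst
      have h3 : (N s - N t) / (B + 1) ≤ k * (t - s) := by linarith
      rw [div_le_iff₀ (by linarith)] at h3
      linarith
  have hNzero : N 0 = nbar := by
    have h1 := hS 0 h0mem
    rw [hrS, ← hg, ENNReal.ofReal_eq_ofReal_iff (thermalEntropy_nonneg hnbar)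
      (thermalEntropy_nonneg (hN0 0))] at h1
    exact le_antisymm ((thermalEntropy_le_iff (hN0 0) hnbar).mp h1.ge)
      ((thermalEntropy_le_iff hnbar (hN0 0)).mp h1.le)
  have hrate : ∀ t ∈ Set.Ioo 0 T, ∀ d, HasDerivAt N d t → γp * (N t + 1) - γm * N t ≤ d := by
    intro t ht d hd
    have hIcc : Set.Icc 0 T ∈ 𝓝 t := Icc_mem_nhds ht.1 ht.2
    -- At `N t = 0` the infinitesimal statement is silent. There `N` has a minimum, so `d = 0`:
    -- enough if `γ₊ = 0`, while `γ₊ > 0` excludes zero entropy.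
    rcases (hN0 t).eq_or_lt with h0 | hpos
    · have hd0 : d = 0 := by
        refine IsLocalMin.hasDerivAt_eq_zero (Eventually.of_forall fun s => ?_) hd
        rw [← h0]; exact hN0 s
      rcases hγp.eq_or_lt with hγ | hγ
      · rw [← h0, hd0, ← hγ]; simp
      · refine absurd ?_ (hr.vnEntropy_ne_zero hγ hγm ht.1)
        rw [hS t ⟨ht.1.le, ht.2.le⟩, ← h0, thermalEntropy_zero, ENNReal.ofReal_zero]
    · refine meanPhotons_rate_le_of_infinitesimal hγp hinf hr ht.1.le ?_ hpos hd
      filter_upwards [hIcc] with s hs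
      exact ⟨hN0 s, hS s hs⟩
  set c := γm - γp with hc
  have hE : ∀ t, HasDerivAt (fun t => Real.exp (c * t)) (c * Real.exp (c * t)) t := by
    intro t
    have := ((hasDerivAt_id t).const_mul c).exp
    simpa [mul_comm] using this
  have hm : ∀ t, HasDerivAt (meanPhotons γp γm nbar)
      (γp * (meanPhotons γp γm nbar t + 1) - γm * meanPhotons γp γm nbar t) t :=
    fun t => hasDerivAt_meanPhotons nbar t
  have hmc : Continuous (meanPhotons γp γm nbar) :=
    continuous_iff_continuousAt.mpr fun t => (hm t).continuousAt
  obtain ⟨L₁, hL₁, hE1⟩ := exists_lipschitz_of_hasDerivAt hE (by fun_prop) T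
  obtain ⟨L₂, hL₂, hP⟩ := exists_lipschitz_of_hasDerivAt (fun t => (hE t).mul (hm t))
    (by fun_prop) T
  -- The integrating factor turns the linear differential inequality for `N - m` into `f' ≥ 0`.
  set f : ℝ → ℝ := fun t => Real.exp (c * t) * (N t - meanPhotons γp γm nbar t) with hf
  -- With `P = e^{ct} m`, `f s - f t = e^{ct}(N s - N t) + (e^{cs} - e^{ct}) N s + (P t - P s)`; the
  -- three summands of the constant bound these three terms.
  have hmono : MonotoneOn (fun t => f t + ((1 + L₁ * T) * (k * (B + 1)) + L₁ * B + L₂) * t)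
      (Set.Icc 0 T) := by
    intro s hs t ht hst
    have h1 := hE1 0 h0mem t ht
    have h2 := hE1 s hs t ht
    have h3 := hP s hs t ht
    have h4 := hNstep s hs t ht hst
    have hts : 0 ≤ t - s := sub_nonneg.mpr hst
    rw [abs_of_nonneg hts] at h2 h3
    rw [sub_zero, abs_of_nonneg ht.1, mul_zero, Real.exp_zero] at h1
    have h5 : Real.exp (c * t) ≤ 1 + L₁ * T := by
      have := (abs_le.mp h1).2
      have : L₁ * t ≤ L₁ * T := mul_le_mul_of_nonneg_left ht.2 hL₁
      linarith
    have hK : 0 ≤ k * (B + 1) * (t - s) :=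
      mul_nonneg (mul_nonneg hk0 (by linarith)) hts
    have h6 : Real.exp (c * t) * (N s - N t) ≤ (1 + L₁ * T) * (k * (B + 1) * (t - s)) :=
      (mul_le_mul_of_nonneg_left h4 (Real.exp_nonneg _)).trans
        (mul_le_mul_of_nonneg_right h5 hK)
    have h7 : (Real.exp (c * s) - Real.exp (c * t)) * N s ≤ L₁ * (t - s) * B := by
      have h8 : Real.exp (c * s) - Real.exp (c * t) ≤ L₁ * (t - s) := by
        have := (abs_le.mp h2).1
        linarith
      exact (mul_le_mul_of_nonneg_right h8 (hN0 s)).trans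
        (mul_le_mul_of_nonneg_left (hNB s hs) (mul_nonneg hL₁ hts))
    have h9 := (abs_le.mp h3).2
    simp only [hf, Pi.mul_apply] at h9 ⊢
    nlinarith
  have hle := le_of_monotoneOn_add_mul hT hmono fun t ht d hd => by
    have hEpos : 0 < Real.exp (c * t) := Real.exp_pos _
    -- Since `N = m + e^{-ct} f`, a derivative of `f` yields one of `N`, to which the rate
    -- inequality applies.
    have hNd : HasDerivAt N
        (-c * Real.exp (-(c * t)) * f t + Real.exp (-(c * t)) * d
          + (γp * (meanPhotons γp γm nbar t + 1) - γm * meanPhotons γp γm nbar t)) t := by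
      have h1 := ((hasDerivAt_exp_neg_mul c t).mul hd).add (hm t)
      refine h1.congr_of_eventuallyEq (Eventually.of_forall fun s => ?_)
      simp only [hf, Pi.add_apply, Pi.mul_apply]
      rw [← mul_assoc, ← Real.exp_add]
      simp
    have h2 := hrate t ht _ hNd
    have h3 : Real.exp (-(c * t)) * f t = N t - meanPhotons γp γm nbar t := by
      simp only [hf]
      rw [← mul_assoc, ← Real.exp_add]
      simp
    have h4 : 0 ≤ Real.exp (-(c * t)) * d := by
      rw [mul_assoc, h3] at h2
      rw [hc] at h2 ⊢
      linarith
    exact nonneg_of_mul_nonneg_right h4 (Real.exp_pos _)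
  simp only [hf, mul_zero, Real.exp_zero, hNzero, meanPhotons_zero, sub_self] at hle
  have hfinal : meanPhotons γp γm nbar T ≤ N T := by
    have := nonneg_of_mul_nonneg_right hle (Real.exp_pos _)
    linarith
  rw [hS T hTmem]
  exact ENNReal.ofReal_le_ofReal
    ((thermalEntropy_le_iff (meanPhotons_nonneg hγp hnbar hT) (hN0 T)).mpr hfinal)
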